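/- Let $\Omega\subset\mathbb R$ be an infinite compact set, and order the space $C(\Omega)$ of continuous real functions on $\Omega$ pointwise. For $m\in\mathbb N=\{0,1,2,\dots\}$ let $\mathcal P_m(\Omega)\subset C(\Omega)$ be the space of restrictions to $\Omega$ of real polynomials of degree at most $m$. A positive basis of a finite-dimensional subspace $X\subseteq C(\Omega)$ is a basis $b_1,\dots,b_n$ of $X$ consisting of functions that are nonnegative on $\Omega$ and such that every $f\in X$ that is nonnegative on $\Omega$ is a linear combination of $b_1,\dots,b_n$ with nonnegative coefficients. A hole of $\Omega$ is a bounded connected component of $\mathbb R\setminus\Omega$. A family of holes is free if the closures of its members are pairwise disjoint, and $\lambda=\lambda(\Omega)\in\{0,1,2,\dots\}\cup\{\infty\}$ is the supremum of the sizes of the free families of holes. A point of $\Omega$ is eccentric if it does not lie in the convex hull of the set $\dot\Omega$ of limit points of $\Omega$; it is a left (right) eccentric point if it is smaller (larger) than all points of $\dot\Omega$. If $\lambda<\infty$ there are only finitely many eccentric points, and $\Theta_\ell,\Theta_r\in\{0,1\}$ denote the parities of the numbers of left and of right eccentric points. Let $[x]$ denote the integer part of $x$. Then the maximal dimension of a subspace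 $X\subseteq\mathcal P_m(\Omega)$ having a positive basis exists and equals $$ \begin{cases} m & \text{if } m\ge 2 \text{ and } \frac m2\le\lambda,\\[1ex] m-\Theta_\ell\Theta_r & \text{if } m\ge 2 \text{ and } \frac{m-1}2=\lambda,\\[1ex] \left[\frac{m-\Theta_\ell-\Theta_r}2\right]+1+\lambda & \text{if } 1\le\lambda\le\frac{m-2}2,\\[1ex] \left[\frac{m+3}2\right] & \text{if } \lambda=0 \text{ (for every } m\ge 0). \end{cases} $$ -/

import Mathlib

/-- The space `P_m(Ω)` of the restrictions to `Ω` of the real polynomials of degree at most `m`,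
as a subspace of `C(Ω)` (which carries the pointwise order). -/
noncomputable def polySpace (Ω : Set ℝ) (m : ℕ) : Submodule ℝ C(Ω, ℝ) :=
  (Polynomial.degreeLE ℝ (m : WithBot ℕ)).map
    (Polynomial.toContinuousMapOnAlgHom Ω).toLinearMap

/-- A basis of a subspace `X` of `C(Ω)` is positive if it consists of functions that are
pointwise nonnegative on `Ω` and if every pointwise nonnegative element of `X` has nonnegative
coordinates in it. -/
def IsPositiveBasis {Ω : Set ℝ} {X : Submodule ℝ C(Ω, ℝ)} {n : ℕ}
    (b : Module.Basis (Fin n) ℝ X) : Prop :=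
  (∀ i, 0 ≤ (b i : C(Ω, ℝ))) ∧ ∀ f : X, 0 ≤ (f : C(Ω, ℝ)) → ∀ i, 0 ≤ b.repr f i

/-- The (finite-dimensional) subspace `X` of `C(Ω)` has a positive basis. -/
def HasPositiveBasis {Ω : Set ℝ} (X : Submodule ℝ C(Ω, ℝ)) : Prop :=
  ∃ (n : ℕ) (b : Module.Basis (Fin n) ℝ X), IsPositiveBasis b

/-- The dimensions of the subspaces of `P_m(Ω)` that have a positive basis. -/
def positiveBasisDims (Ω : Set ℝ) (m : ℕ) : Set ℕ :=
  {d | ∃ X : Submodule ℝ C(Ω, ℝ),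
    X ≤ polySpace Ω m ∧ HasPositiveBasis X ∧ Module.finrank ℝ X = d}

/-- The holes of a compact set `Ω`: the bounded connected components `(α, β)` of `ℝ \ Ω`, each
recorded by the pair of its endpoints. -/
def holes (Ω : Set ℝ) : Set (ℝ × ℝ) :=
  {I | I.1 ∈ Ω ∧ I.2 ∈ Ω ∧ I.1 < I.2 ∧ Disjoint (Set.Ioo I.1 I.2) Ω}

/-- A free family of holes: the closures of its members are pairwise disjoint. -/
def IsFreeFamily (Ω : Set ℝ) (L : Set (ℝ × ℝ)) : Prop :=
  L ⊆ holes Ω ∧ L.Pairwise fun I J => Disjoint (Set.Icc I.1 I.2) (Set.Icc J.1 J.2)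

/-- `λ(Ω)`, the maximal size of a free family of holes (possibly infinite). -/
noncomputable def holeNumber (Ω : Set ℝ) : ℕ∞ :=
  ⨆ (L : Set (ℝ × ℝ)) (_ : IsFreeFamily Ω L), L.encard

/-- The eccentric points: the points of `Ω` outside the convex hull of the set of limit points
of `Ω`. -/
def eccentricPoints (Ω : Set ℝ) : Set ℝ :=
  Ω \ convexHull ℝ (derivedSet Ω)

/-- The eccentric points on the left-hand side. -/
def leftEccentric (Ω : Set ℝ) : Set ℝ :=
  {x ∈ eccentricPoints Ω | ∀ y ∈ derivedSet Ω, x < y}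

/-- The eccentric points on the right-hand side. -/
def rightEccentric (Ω : Set ℝ) : Set ℝ :=
  {x ∈ eccentricPoints Ω | ∀ y ∈ derivedSet Ω, y < x}

/-- `Θ_ℓ ∈ {0, 1}`, the parity of the number of left eccentric points; meaningful only if this
number is finite, as it is whenever `λ(Ω)` is finite. -/
noncomputable def thetaLeft (Ω : Set ℝ) : ℕ := (leftEccentric Ω).ncard % 2

/-- `Θ_r ∈ {0, 1}`, the parity of the number of right eccentric points; meaningful only if this
number is finite, as it is whenever `λ(Ω)` is finite. -/
noncomputable def thetaRight (Ω : Set ℝ) : ℕ := (rightEccentric Ω).ncard % 2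

/-! A positive basis of dimension `n` is traded for a `NodeSystem`: `n` points of `Ω` and `n`
polynomials of degree at most `m`, nonnegative on `Ω`, each positive at its own node and zero at the
others. Each basis element must dominate the others somewhere (`IsDominating`), since otherwise the
sum of the others minus a small multiple of it would be nonnegative with a negative coordinate.
Compactness gives a limit point of the dominating places; if all the polynomials vanish there, the
common zero is cancelled (`exists_cancel`) and the argument repeated. Conversely, node polynomials
form a positive basis of their span (`IsConfig.card_mem`). So the question is how many nodes fit.

Upper bounds count zeros. A zero of even multiplicity costs degree at least two. Zeros with a sign
change can cost one, but where `f < 0` there are no points of `Ω`, so two consecutive cheap sign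
changes lead to a hole with both endpoints zeros; only the extreme points of `Ω` can carry an
unpaired one. This gives `2 Z ≤ deg f + 2 #F + sl + sr` for a free family `F`
(`exists_isFree_two_mul_ncard_zerosIn_le`). An odd number of eccentric points on one side means that
a family not using the extreme point there can be enlarged, whence `#F + Θ_ℓ sl + Θ_r sr ≤ λ`
(`IsFree.card_add_le`). If all these estimates are tight for every node polynomial, each zero is a
node, and the node polynomial that is positive at a well chosen zero allows a further hole; this
saves the last unit (`NodeSystem.two_mul_add_le`). The bound `n ≤ m` is an interpolation argument
(`NodeSystem.le_degree`).

Lower bounds multiply local factors: a hole gives two nodes for degree two, an extreme point of `Ω`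
one node for degree one, any other point one node for degree two. The parities decide whether a
maximal free family can leave the extreme points available. -/

/-! ### Finite free families of holes -/

/-- A finite free family of holes, with disjointness of the closures spelled out. -/
def IsFree (Ω : Set ℝ) (F : Finset (ℝ × ℝ)) : Prop :=
  (∀ I ∈ F, I ∈ holes Ω) ∧ ∀ I ∈ F, ∀ J ∈ F, I ≠ J → I.2 < J.1 ∨ J.2 < I.1

theorem disjoint_Icc_iff_lt {a b c d : ℝ} (h : a ≤ b) (h' : c ≤ d) :
    Disjoint (Set.Icc a b) (Set.Icc c d) ↔ b < c ∨ d < a := by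
  constructor
  · intro hd
    by_contra! hn
    exact Set.disjoint_left.1 hd (show max a c ∈ _ from ⟨le_max_left _ _, max_le h hn.1⟩)
      ⟨le_max_right _ _, max_le hn.2 h'⟩
  · rintro (h1 | h1) <;> refine Set.disjoint_left.2 fun x hx hx' => ?_
    · linarith [hx.2, hx'.1]
    · linarith [hx.1, hx'.2]

theorem isFree_iff {Ω : Set ℝ} {F : Finset (ℝ × ℝ)} :
    IsFree Ω F ↔ IsFreeFamily Ω (F : Set (ℝ × ℝ)) := by
  constructor
  · rintro ⟨h1, h2⟩
    refine ⟨fun I hI => h1 I hI, fun I hI J hJ hIJ => ?_⟩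
    exact (disjoint_Icc_iff_lt (h1 I hI).2.2.1.le (h1 J hJ).2.2.1.le).2 (h2 I hI J hJ hIJ)
  · rintro ⟨h1, h2⟩
    refine ⟨fun I hI => h1 hI, fun I hI J hJ hIJ => ?_⟩
    exact (disjoint_Icc_iff_lt (h1 hI).2.2.1.le (h1 hJ).2.2.1.le).1 (h2 hI hJ hIJ)

theorem IsFree.card_le {Ω : Set ℝ} {F : Finset (ℝ × ℝ)} (h : IsFree Ω F) :
    (F.card : ℕ∞) ≤ holeNumber Ω := by
  rw [← Set.encard_coe_eq_coe_finsetCard]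
  exact le_iSup₂_of_le (F : Set (ℝ × ℝ)) (isFree_iff.1 h) le_rfl

theorem IsFree.mono {Ω : Set ℝ} {F G : Finset (ℝ × ℝ)} (h : IsFree Ω F) (hG : G ⊆ F) :
    IsFree Ω G :=
  ⟨fun I hI => h.1 I (hG hI), fun I hI J hJ => h.2 I (hG hI) J (hG hJ)⟩

theorem exists_isFree_card_eq {Ω : Set ℝ} {k : ℕ} (hk : (k : ℕ∞) ≤ holeNumber Ω) :
    ∃ F, IsFree Ω F ∧ F.card = k := by
  obtain ⟨L, hL, hkL⟩ : ∃ L, IsFreeFamily Ω L ∧ (k : ℕ∞) ≤ L.encard := by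
    by_contra! hn
    rcases k with _ | k
    · exact not_lt_bot (hn ∅ ⟨Set.empty_subset _, Set.pairwise_empty _⟩)
    · have : holeNumber Ω ≤ k := by
        refine iSup₂_le fun L hL => ?_
        have := hn L hL
        rw [Nat.cast_add, Nat.cast_one] at this
        exact Order.le_of_lt_add_one this
      have := hk.trans this
      norm_cast at this
      omega
  obtain ⟨L', hL', hc⟩ := Set.exists_subset_encard_eq hkL
  have hf : L'.Finite := Set.finite_of_encard_eq_coe hc
  refine ⟨hf.toFinset, isFree_iff.2 ?_, ?_⟩
  · rw [hf.coe_toFinset]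
    exact ⟨hL'.trans hL.1, hL.2.mono hL'⟩
  · rw [hf.encard_eq_coe_toFinset_card] at hc
    exact_mod_cast hc

theorem IsFree.insert_hole {Ω : Set ℝ} {F : Finset (ℝ × ℝ)} (h : IsFree Ω F) {I : ℝ × ℝ}
    (hI : I ∈ holes Ω) (hd : ∀ J ∈ F, I.2 < J.1 ∨ J.2 < I.1) :
    IsFree Ω (insert I F) ∧ (insert I F).card = F.card + 1 := by
  have hlt := hI.2.2.1
  refine ⟨⟨?_, ?_⟩, Finset.card_insert_of_notMem fun hm => ?_⟩
  · intro J hJ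
    rcases Finset.mem_insert.1 hJ with rfl | hJ
    · exact hI
    · exact h.1 J hJ
  · intro J hJ K hK hne
    rcases Finset.mem_insert.1 hJ with rfl | hJF <;> rcases Finset.mem_insert.1 hK with rfl | hKF
    · exact absurd rfl hne
    · exact hd K hKF
    · exact (hd J hJF).symm
    · exact h.2 J hJF K hKF hne
  · rcases hd I hm with h1 | h1 <;> linarith

theorem IsFree.union {Ω : Set ℝ} {F G : Finset (ℝ × ℝ)} (hF : IsFree Ω F) (hG : IsFree Ω G)
    (hd : ∀ I ∈ F, ∀ J ∈ G, I.2 < J.1) :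
    IsFree Ω (F ∪ G) ∧ (F ∪ G).card = F.card + G.card := by
  refine ⟨⟨?_, ?_⟩, Finset.card_union_of_disjoint (Finset.disjoint_left.2 fun I hI hI' => ?_)⟩
  · intro I hI
    rcases Finset.mem_union.1 hI with hI | hI
    exacts [hF.1 I hI, hG.1 I hI]
  · intro I hI J hJ hne
    rcases Finset.mem_union.1 hI with hI | hI <;> rcases Finset.mem_union.1 hJ with hJ | hJ
    · exact hF.2 I hI J hJ hne
    · exact Or.inl (hd I hI J hJ)
    · exact Or.inr (hd J hJ I hI)
    · exact hG.2 I hI J hJ hne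
  · have := hd I hI I hI'
    linarith [(hF.1 I hI).2.2.1]

/-! ### Rearranging holes near the eccentric points -/

/-- If only `e` points of `Ω` lie below `c ∈ Ω`, the holes below `c` contain a free family of
`⌈e / 2⌉` members; for even `e` it leaves the least point of `Ω` unused. -/
theorem exists_isFree_le {Ω : Set ℝ} (e : ℕ) : ∀ (c : ℝ) (E : Finset ℝ), c ∈ Ω →
    (E : Set ℝ) = Ω ∩ Set.Iio c → E.card = e →
    ∃ L, IsFree Ω L ∧ L.card = (e + 1) / 2 ∧ (∀ I ∈ L, I.2 ≤ c) ∧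
      (Even e → ∀ I ∈ L, ∃ y ∈ Ω, y < I.1) := by
  induction e using Nat.strong_induction_on with
  | _ e ih =>
    intro c E hc hE hcard
    have hmem : ∀ x, x ∈ E ↔ x ∈ Ω ∧ x < c := fun x => by
      rw [← Finset.mem_coe, hE]; rfl
    rcases E.eq_empty_or_nonempty with rfl | hne
    · refine ⟨∅, ⟨by simp, by simp⟩, ?_, by simp, by simp⟩
      simp at hcard
      simp [← hcard]
    -- The points are paired from the right: the hole `(q, c)` is taken, and the recursion resumes
    -- at the predecessor `p` of `q`, so that closures stay disjoint.
    have hqE := E.max'_mem hne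
    set q := E.max' hne with hq
    have hqc := (hmem q).1 hqE
    have hhole : (q, c) ∈ holes Ω := by
      refine ⟨hqc.1, hc, hqc.2, Set.disjoint_left.2 fun x hx hxΩ => ?_⟩
      exact absurd (E.le_max' x ((hmem x).2 ⟨hxΩ, hx.2⟩)) (not_le.2 hx.1)
    rcases (E.erase q).eq_empty_or_nonempty with h0 | hne'
    · have h1 : e = 1 := by
        have := Finset.card_erase_of_mem hqE
        rw [h0, hcard, Finset.card_empty] at this
        have := Finset.card_pos.2 hne
        omega
      subst h1
      refine ⟨{(q, c)}, ⟨by simpa using hhole, by simp⟩, by simp, by simp, ?_⟩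
      intro h; exact absurd h (by decide)
    have hpE := (E.erase q).max'_mem hne'
    set p := (E.erase q).max' hne' with hp
    have hpE' := Finset.mem_of_mem_erase hpE
    have hpq : p < q := lt_of_le_of_ne (E.le_max' p hpE') (Finset.ne_of_mem_erase hpE)
    have hE2 : (((E.erase q).erase p : Finset ℝ) : Set ℝ) = Ω ∩ Set.Iio p := by
      ext x
      simp only [Finset.mem_coe, Finset.mem_erase, Set.mem_inter_iff, Set.mem_Iio, hmem]
      constructor
      · rintro ⟨h1, h2, h3, h4⟩
        refine ⟨h3, lt_of_le_of_ne ((E.erase q).le_max' x ?_) h1⟩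
        exact Finset.mem_erase.2 ⟨h2, (hmem x).2 ⟨h3, h4⟩⟩
      · rintro ⟨h1, h2⟩
        exact ⟨h2.ne, (h2.trans hpq).ne, h1, (h2.trans hpq).trans hqc.2⟩
    have hc2 : ((E.erase q).erase p).card = e - 2 := by
      rw [Finset.card_erase_of_mem hpE, Finset.card_erase_of_mem hqE, hcard]; rfl
    have he : 2 ≤ e := by
      have := Finset.card_pos.2 hne'
      rw [Finset.card_erase_of_mem hqE] at this
      omega
    obtain ⟨L, hL, hLc, hLp, hLe⟩ := ih (e - 2) (by omega) p _ ((hmem p).1 hpE').1 hE2 hc2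
    obtain ⟨h1, h2⟩ := hL.insert_hole hhole fun J hJ => Or.inr ((hLp J hJ).trans_lt hpq)
    refine ⟨_, h1, by omega, ?_, ?_⟩
    · intro I hI
      rcases Finset.mem_insert.1 hI with rfl | hI
      · exact le_rfl
      · exact (hLp I hI).trans (hpq.trans hqc.2).le
    · intro hev I hI
      rcases Finset.mem_insert.1 hI with rfl | hI
      · exact ⟨p, ((hmem p).1 hpE').1, hpq⟩
      · refine hLe ?_ I hI
        rw [Nat.even_sub he]; simp [hev]

/-- Twice the number of members of a free family with endpoints in `E` is at most `#E`. -/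
theorem IsFree.two_mul_card_le {Ω : Set ℝ} {F : Finset (ℝ × ℝ)} (h : IsFree Ω F) {E : Finset ℝ}
    (hE : ∀ I ∈ F, I.1 ∈ E ∧ I.2 ∈ E) : 2 * F.card ≤ E.card := by
  have h1 : (F.image Prod.fst).card = F.card := Finset.card_image_of_injOn fun I hI J hJ hIJ => by
    by_contra hne
    have := (h.1 I hI).2.2.1
    have := (h.1 J hJ).2.2.1
    rcases h.2 I hI J hJ hne with h2 | h2 <;> linarith
  have h2 : (F.image Prod.snd).card = F.card := Finset.card_image_of_injOn fun I hI J hJ hIJ => by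
    by_contra hne
    have := (h.1 I hI).2.2.1
    have := (h.1 J hJ).2.2.1
    rcases h.2 I hI J hJ hne with h2 | h2 <;> linarith
  have hd : Disjoint (F.image Prod.fst) (F.image Prod.snd) := by
    refine Finset.disjoint_left.2 fun x hx hx' => ?_
    obtain ⟨I, hI, rfl⟩ := Finset.mem_image.1 hx
    obtain ⟨J, hJ, hIJ⟩ := Finset.mem_image.1 hx'
    have h3 := (h.1 I hI).2.2.1
    have h4 := (h.1 J hJ).2.2.1
    by_cases hne : I = J
    · subst hne; linarith
    · rcases h.2 I hI J hJ hne with h2 | h2 <;> linarith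
  have := Finset.card_le_card (s := F.image Prod.fst ∪ F.image Prod.snd) (t := E) (by
    intro x hx
    rcases Finset.mem_union.1 hx with hx | hx <;> obtain ⟨I, hI, rfl⟩ := Finset.mem_image.1 hx
    exacts [(hE I hI).1, (hE I hI).2])
  rw [Finset.card_union_of_disjoint hd] at this
  omega

/-- Rearranging the members of a free family below a point `c` of `Ω` that has only finitely many
points of `Ω` below it and is not the left end of a hole. -/
theorem IsFree.exists_exchange_left {Ω : Set ℝ} {F : Finset (ℝ × ℝ)} (hF : IsFree Ω F) {a c : ℝ}
    (ha : IsLeast Ω a) (hc : c ∈ Ω) (hfin : (Ω ∩ Set.Iio c).Finite)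
    (hacc : ∀ x, c < x → ∃ y ∈ Ω, c < y ∧ y < x) :
    ∃ F', IsFree Ω F' ∧ (∀ I ∈ F', I ∈ F ∨ I.2 ≤ c) ∧ F.card ≤ F'.card ∧
      ((Ω ∩ Set.Iio c).ncard % 2 = 0 → ∀ I ∈ F', I.1 ≠ a) ∧
      ((Ω ∩ Set.Iio c).ncard % 2 = 1 → (∀ I ∈ F, I.1 ≠ a) → F.card + 1 ≤ F'.card) := by
  classical
  set E := hfin.toFinset with hE
  have hcoe : (E : Set ℝ) = Ω ∩ Set.Iio c := hfin.coe_toFinset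
  have hmem : ∀ x, x ∈ E ↔ x ∈ Ω ∧ x < c := fun x => by
    rw [← Finset.mem_coe, hcoe]; rfl
  have hcE : (Ω ∩ Set.Iio c).ncard = E.card := by rw [← hcoe, Set.ncard_coe_finset]
  rw [hcE]
  obtain ⟨L, hL, hLc, hLle, hLe⟩ := exists_isFree_le E.card c E hc hcoe rfl
  set A := F.filter fun I => I.1 < c with hA
  set B := F.filter fun I => ¬ I.1 < c with hB
  have hAB : A.card + B.card = F.card := Finset.card_filter_add_card_filter_not _
  have hBlt : ∀ J ∈ B, c < J.1 := by
    intro J hJ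
    obtain ⟨hJF, hJc⟩ := Finset.mem_filter.1 hJ
    refine lt_of_le_of_ne (not_lt.1 hJc) fun heq => ?_
    have hJh := hF.1 J hJF
    obtain ⟨y, hy, hy1, hy2⟩ := hacc J.2 (heq ▸ hJh.2.2.1)
    exact Set.disjoint_left.1 hJh.2.2.2 ⟨heq ▸ hy1, hy2⟩ hy
  have hBfree : IsFree Ω B := hF.mono (Finset.filter_subset _ _)
  have hAfree : IsFree Ω A := hF.mono (Finset.filter_subset _ _)
  have hAmem : ∀ I ∈ A, I.1 ∈ E ∧ I.2 ∈ insert c E := by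
    intro I hI
    obtain ⟨hIF, hIc⟩ := Finset.mem_filter.1 hI
    have hIh := hF.1 I hIF
    refine ⟨(hmem _).2 ⟨hIh.1, hIc⟩, ?_⟩
    rw [Finset.mem_insert, hmem]
    rcases lt_trichotomy I.2 c with h | h | h
    · exact Or.inr ⟨hIh.2.1, h⟩
    · exact Or.inl h
    · exact absurd hc (Set.disjoint_left.1 hIh.2.2.2 ⟨hIc, h⟩)
  have hcn : c ∉ E := fun h => lt_irrefl c ((hmem c).1 h).2
  -- The members below `c` have their endpoints among the points of `E` and `c`, so replacing them
  -- by `L` loses nothing.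
  have hA1 : 2 * A.card ≤ E.card + 1 := by
    rw [← Finset.card_insert_of_notMem hcn]
    exact hAfree.two_mul_card_le fun I hI =>
      ⟨Finset.mem_insert_of_mem (hAmem I hI).1, (hAmem I hI).2⟩
  obtain ⟨h1, h2⟩ := hL.union hBfree fun I hI J hJ => (hLle I hI).trans_lt (hBlt J hJ)
  refine ⟨_, h1, ?_, by omega, ?_, ?_⟩
  · intro I hI
    rcases Finset.mem_union.1 hI with hI | hI
    · exact Or.inr (hLle I hI)
    · exact Or.inl (Finset.mem_filter.1 hI).1
  · intro hev I hI heq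
    rcases Finset.mem_union.1 hI with hI | hI
    · obtain ⟨y, hy, hlt⟩ := hLe (Nat.even_iff.2 hev) I hI
      exact absurd (ha.2 hy) (not_le.2 (heq ▸ hlt))
    · have := hBlt I hI
      have := ha.2 hc
      linarith
  · intro hodd hav
    have haE : a ∈ E := by
      obtain ⟨x, hx⟩ : E.Nonempty := Finset.card_pos.1 (by omega)
      exact (hmem a).2 ⟨ha.1, (ha.2 ((hmem x).1 hx).1).trans_lt ((hmem x).1 hx).2⟩
    -- With `a` unavailable only `#E` endpoints remain; as this number is odd, `L` has one member
    -- more than `A`.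
    have hA2 : 2 * A.card ≤ E.card := by
      have h3 : ((insert c E).erase a).card = E.card := by
        rw [Finset.card_erase_of_mem (Finset.mem_insert_of_mem haE),
          Finset.card_insert_of_notMem hcn, Nat.add_sub_cancel]
      rw [← h3]
      refine hAfree.two_mul_card_le fun I hI => ?_
      have hIF := (Finset.mem_filter.1 hI).1
      have hIh := hF.1 I hIF
      refine ⟨Finset.mem_erase.2 ⟨hav I hIF, Finset.mem_insert_of_mem (hAmem I hI).1⟩,
        Finset.mem_erase.2 ⟨?_, (hAmem I hI).2⟩⟩
      exact ((ha.2 hIh.1).trans_lt hIh.2.2.1).ne'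
    omega

theorem finite_inter_Iio_of_lt {Ω : Set ℝ} (hΩ : IsCompact Ω) {c p : ℝ}
    (hc : ∀ y ∈ derivedSet Ω, c ≤ y) (hp : p < c) : (Ω ∩ Set.Iio p).Finite := by
  by_contra hinf
  obtain ⟨x, -, hx⟩ := Set.Infinite.exists_accPt_of_subset_isCompact (s := Ω ∩ Set.Iio p) hinf
    hΩ Set.inter_subset_left
  have h1 : c ≤ x := hc x (derivedSet_mono _ _ Set.inter_subset_left hx)
  have h2 : x ∈ closure (Set.Iio p) :=
    closure_mono Set.inter_subset_right (derivedSet_subset_closure _ hx)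
  rw [closure_Iio, Set.mem_Iic] at h2
  linarith

/-- Infinitely many points below the derived set would give arbitrarily large free families: among
`2k + 2` of them the largest has at least `2k + 1` points of `Ω` below it, hence `k + 1` free holes.
-/
theorem finite_inter_Iio {Ω : Set ℝ} (hΩ : IsCompact Ω) (htop : holeNumber Ω ≠ ⊤) {c : ℝ}
    (hc : ∀ y ∈ derivedSet Ω, c ≤ y) : (Ω ∩ Set.Iio c).Finite := by
  by_contra hinf
  obtain ⟨k, hk⟩ := ENat.ne_top_iff_exists.1 htop
  obtain ⟨S, hS, hScard⟩ := Set.Infinite.exists_subset_card_eq hinf (2 * k + 2)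
  have hne : S.Nonempty := Finset.card_pos.1 (by omega)
  have hp := hS (S.max'_mem hne)
  have hfin := finite_inter_Iio_of_lt hΩ hc hp.2
  obtain ⟨L, hL, hLc, -⟩ := exists_isFree_le _ (S.max' hne) hfin.toFinset hp.1 hfin.coe_toFinset rfl
  have hsub : S.erase (S.max' hne) ⊆ hfin.toFinset := by
    intro x hx
    rw [Set.Finite.mem_toFinset]
    exact ⟨(hS (Finset.mem_of_mem_erase hx)).1,
      lt_of_le_of_ne (S.le_max' x (Finset.mem_of_mem_erase hx)) (Finset.ne_of_mem_erase hx)⟩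
  have hcard := Finset.card_le_card hsub
  rw [Finset.card_erase_of_mem (S.max'_mem hne), hScard] at hcard
  have := hL.card_le
  rw [← hk, hLc] at this
  norm_cast at this
  omega

/-! ### Reflection and the right-hand end -/

/-- The mirror image of a set of reals. -/
def reflect (Ω : Set ℝ) : Set ℝ := {x | -x ∈ Ω}

theorem reflect_eq_image (Ω : Set ℝ) : reflect Ω = (fun x : ℝ => -x) '' Ω := by
  ext x
  constructor
  · intro hx
    exact ⟨-x, hx, neg_neg x⟩
  · rintro ⟨y, hy, rfl⟩
    simpa [reflect] using hy

theorem reflect_reflect (Ω : Set ℝ) : reflect (reflect Ω) = Ω := by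
  ext x; simp [reflect]

theorem isCompact_reflect {Ω : Set ℝ} (hΩ : IsCompact Ω) : IsCompact (reflect Ω) := by
  rw [reflect_eq_image]; exact hΩ.image continuous_neg

theorem neg_mem_derivedSet_of_mem_reflect {Ω : Set ℝ} {y : ℝ} (hy : y ∈ derivedSet (reflect Ω)) :
    -y ∈ derivedSet Ω := by
  have h := continuous_neg.image_derivedSet neg_injective (A := reflect Ω) (Set.mem_image_of_mem _ hy)
  rwa [← reflect_eq_image (reflect Ω), reflect_reflect] at h

/-- The mirror image of a family of intervals. -/
noncomputable def reflectFamily (F : Finset (ℝ × ℝ)) : Finset (ℝ × ℝ) := F.image fun I => (-I.2, -I.1)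

theorem card_reflectFamily (F : Finset (ℝ × ℝ)) : (reflectFamily F).card = F.card :=
  Finset.card_image_of_injective _ fun I J h => by
    simp only [Prod.mk.injEq, neg_inj] at h
    exact Prod.ext h.2 h.1

theorem mem_reflectFamily {F : Finset (ℝ × ℝ)} {I : ℝ × ℝ} :
    I ∈ reflectFamily F ↔ (-I.2, -I.1) ∈ F := by
  constructor
  · intro h
    obtain ⟨J, hJ, rfl⟩ := Finset.mem_image.1 h
    simpa using hJ
  · intro h
    exact Finset.mem_image.2 ⟨_, h, by simp⟩

theorem IsFree.reflect {Ω : Set ℝ} {F : Finset (ℝ × ℝ)} (h : IsFree Ω F) :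
    IsFree (reflect Ω) (reflectFamily F) := by
  constructor
  · intro I hI
    obtain ⟨h1, h2, h3, h4⟩ := h.1 _ (mem_reflectFamily.1 hI)
    refine ⟨h2, h1, neg_lt_neg_iff.1 h3, Set.disjoint_left.2 fun x hx hxΩ => ?_⟩
    exact Set.disjoint_left.1 h4 (show -x ∈ _ from ⟨neg_lt_neg hx.2, neg_lt_neg hx.1⟩) hxΩ
  · intro I hI J hJ hne
    rcases h.2 _ (mem_reflectFamily.1 hI) _ (mem_reflectFamily.1 hJ) (by
      contrapose! hne
      simp only [Prod.mk.injEq, neg_inj] at hne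
      exact Prod.ext hne.2 hne.1) with h1 | h1
    · exact Or.inr (neg_lt_neg_iff.1 h1)
    · exact Or.inl (neg_lt_neg_iff.1 h1)

theorem holeNumber_reflect_ne_top {Ω : Set ℝ} (h : holeNumber Ω ≠ ⊤) :
    holeNumber (reflect Ω) ≠ ⊤ := by
  obtain ⟨k, hk⟩ := ENat.ne_top_iff_exists.1 h
  intro htop
  obtain ⟨F, hF, hFc⟩ := exists_isFree_card_eq (Ω := reflect Ω) (k := k + 1) (by simp [htop])
  have := hF.reflect
  rw [reflect_reflect] at this
  have := this.card_le
  rw [card_reflectFamily, hFc, ← hk] at this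
  norm_cast at this
  omega

theorem ncard_reflect_inter_Iio (Ω : Set ℝ) (c : ℝ) :
    (reflect Ω ∩ Set.Iio (-c)).ncard = (Ω ∩ Set.Ioi c).ncard := by
  rw [← Set.ncard_image_of_injective (Ω ∩ Set.Ioi c) neg_injective]
  congr 1
  ext x
  constructor
  · rintro ⟨h1, h2⟩
    exact ⟨-x, ⟨h1, Set.mem_Ioi.2 (lt_neg_of_lt_neg h2)⟩, neg_neg x⟩
  · rintro ⟨y, ⟨h1, h2⟩, rfl⟩
    exact ⟨by simpa [reflect] using h1, Set.mem_Iio.2 (neg_lt_neg h2)⟩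

theorem finite_inter_Ioi {Ω : Set ℝ} (hΩ : IsCompact Ω) (htop : holeNumber Ω ≠ ⊤) {c : ℝ}
    (hc : ∀ y ∈ derivedSet Ω, y ≤ c) : (Ω ∩ Set.Ioi c).Finite := by
  have := finite_inter_Iio (isCompact_reflect hΩ) (holeNumber_reflect_ne_top htop) (c := -c)
    fun y hy => neg_le.1 (hc _ (neg_mem_derivedSet_of_mem_reflect hy))
  refine (this.image fun x => -x).subset fun x hx => ⟨-x, ⟨?_, Set.mem_Iio.2 (neg_lt_neg hx.2)⟩, neg_neg x⟩
  simpa [reflect] using hx.1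

/-- The mirror image of `IsFree.exists_exchange_left`. -/
theorem IsFree.exists_exchange_right {Ω : Set ℝ} {F : Finset (ℝ × ℝ)} (hF : IsFree Ω F) {b c : ℝ}
    (hb : IsGreatest Ω b) (hc : c ∈ Ω) (hfin : (Ω ∩ Set.Ioi c).Finite)
    (hacc : ∀ x, x < c → ∃ y ∈ Ω, x < y ∧ y < c) :
    ∃ F', IsFree Ω F' ∧ (∀ I ∈ F', I ∈ F ∨ c ≤ I.1) ∧ F.card ≤ F'.card ∧
      ((Ω ∩ Set.Ioi c).ncard % 2 = 0 → ∀ I ∈ F', I.2 ≠ b) ∧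
      ((Ω ∩ Set.Ioi c).ncard % 2 = 1 → (∀ I ∈ F, I.2 ≠ b) → F.card + 1 ≤ F'.card) := by
  have hmem : ∀ {x}, x ∈ Ω → -x ∈ _root_.reflect Ω := fun {x} hx => by simpa [_root_.reflect] using hx
  obtain ⟨F', h1, h2, h3, h4, h5⟩ := hF.reflect.exists_exchange_left (a := -b) (c := -c)
    ⟨hmem hb.1, fun x hx => neg_le.1 (hb.2 hx)⟩ (hmem hc)
    ((hfin.image fun x => -x).subset fun x hx => ⟨-x, ⟨hx.1, Set.mem_Ioi.2 (lt_neg_of_lt_neg hx.2)⟩, neg_neg x⟩)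
    (fun x hx => by
      obtain ⟨y, hy, hy1, hy2⟩ := hacc (-x) (neg_lt.1 hx)
      exact ⟨-y, hmem hy, neg_lt_neg hy2, neg_lt.1 hy1⟩)
  rw [ncard_reflect_inter_Iio] at h4 h5
  rw [card_reflectFamily] at h3 h5
  refine ⟨reflectFamily F', ?_, ?_, ?_, ?_, ?_⟩
  · simpa [reflect_reflect] using h1.reflect
  · intro I hI
    rcases h2 _ (mem_reflectFamily.1 hI) with h | h
    · left; simpa using mem_reflectFamily.1 h
    · right; exact neg_le_neg_iff.1 h
  · rwa [card_reflectFamily]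
  · intro h I hI heq
    exact h4 h _ (mem_reflectFamily.1 hI) (by simp [heq])
  · rw [card_reflectFamily]
    intro h hav
    refine h5 h fun I hI heq => ?_
    exact hav _ (mem_reflectFamily.1 hI) (by simp [heq])

/-! ### Parity bounds at both ends -/

/-- What a compact infinite set with finite hole number looks like near the extreme points
`c < c'` of its derived set. -/
theorem exists_extreme_limit_points {Ω : Set ℝ} (hΩ : IsCompact Ω) (hinf : Ω.Infinite)
    (htop : holeNumber Ω ≠ ⊤) :
    ∃ c c', c ∈ Ω ∧ c' ∈ Ω ∧ c < c' ∧
      (Ω ∩ Set.Iio c).Finite ∧ (Ω ∩ Set.Ioi c').Finite ∧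
      (∀ x, c < x → ∃ y ∈ Ω, c < y ∧ y < x) ∧ (∀ x, x < c' → ∃ y ∈ Ω, x < y ∧ y < c') ∧
      leftEccentric Ω = Ω ∩ Set.Iio c ∧ rightEccentric Ω = Ω ∩ Set.Ioi c' := by
  have hDΩ : derivedSet Ω ⊆ Ω := (isClosed_iff_derivedSet_subset Ω).1 hΩ.isClosed
  have hDc : IsCompact (derivedSet Ω) := hΩ.of_isClosed_subset (isClosed_derivedSet Ω) hDΩ
  have hDne : (derivedSet Ω).Nonempty := by
    obtain ⟨x, -, hx⟩ := hinf.exists_accPt_of_subset_isCompact hΩ subset_rfl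
    exact ⟨x, hx⟩
  obtain ⟨c, hc⟩ := hDc.exists_isLeast hDne
  obtain ⟨c', hc'⟩ := hDc.exists_isGreatest hDne
  have hf := finite_inter_Iio hΩ htop fun y hy => hc.2 hy
  have hf' := finite_inter_Ioi hΩ htop fun y hy => hc'.2 hy
  have hcc : c < c' := by
    refine lt_of_le_of_ne (hc.2 hc'.1) fun heq => hinf ?_
    refine ((hf.union hf').union (Set.finite_singleton c)).subset fun x hx => ?_
    rcases lt_trichotomy x c with h | h | h
    · exact Or.inl (Or.inl ⟨hx, h⟩)
    · exact Or.inr h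
    · exact Or.inl (Or.inr ⟨hx, heq ▸ h⟩)
  have hnhds : ∀ {z : ℝ} {s : Set ℝ}, s.Finite → z ∉ s → ∀ᶠ y in nhds z, y ∉ s := fun hs hz =>
    hs.isClosed.isOpen_compl.mem_nhds hz
  have hull : convexHull ℝ (derivedSet Ω) = Set.Icc c c' := by
    refine subset_antisymm (convexHull_min (fun x hx => ⟨hc.2 hx, hc'.2 hx⟩) (convex_Icc c c')) ?_
    rw [← segment_eq_Icc hcc.le]
    exact segment_subset_convexHull hc.1 hc'.1
  refine ⟨c, c', hDΩ hc.1, hDΩ hc'.1, hcc, hf, hf', ?_, ?_, ?_, ?_⟩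
  · intro x hx
    obtain ⟨y, ⟨hy1, hy2⟩, hy3, hy4⟩ := ((accPt_iff_frequently.1 hc.1).and_eventually
      ((hnhds hf (fun h => lt_irrefl c h.2)).and (Iio_mem_nhds hx))).exists
    refine ⟨y, hy2, lt_of_le_of_ne (not_lt.1 fun h => hy3 ⟨hy2, h⟩) hy1.symm, hy4⟩
  · intro x hx
    obtain ⟨y, ⟨hy1, hy2⟩, hy3, hy4⟩ := ((accPt_iff_frequently.1 hc'.1).and_eventually
      ((hnhds hf' (fun h => lt_irrefl c' h.2)).and (Ioi_mem_nhds hx))).exists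
    refine ⟨y, hy2, hy4, lt_of_le_of_ne (not_lt.1 fun h => hy3 ⟨hy2, h⟩) hy1⟩
  · ext x
    simp only [leftEccentric, eccentricPoints, hull, Set.mem_ofPred_eq, Set.mem_sdiff,
      Set.mem_inter_iff, Set.mem_Iio]
    constructor
    · rintro ⟨⟨h1, -⟩, h2⟩
      exact ⟨h1, h2 c hc.1⟩
    · rintro ⟨h1, h2⟩
      exact ⟨⟨h1, fun h => absurd h.1 (not_le.2 h2)⟩, fun y hy => h2.trans_le (hc.2 hy)⟩
  · ext x
    simp only [rightEccentric, eccentricPoints, hull, Set.mem_ofPred_eq, Set.mem_sdiff,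
      Set.mem_inter_iff, Set.mem_Ioi]
    constructor
    · rintro ⟨⟨h1, -⟩, h2⟩
      exact ⟨h1, h2 c' hc'.1⟩
    · rintro ⟨h1, h2⟩
      exact ⟨⟨h1, fun h => absurd h.2 (not_le.2 h2)⟩, fun y hy => (hc'.2 hy).trans_lt h2⟩

theorem thetaLeft_le_one (Ω : Set ℝ) : thetaLeft Ω ≤ 1 :=
  Nat.le_of_lt_succ (Nat.mod_lt _ two_pos)

theorem thetaRight_le_one (Ω : Set ℝ) : thetaRight Ω ≤ 1 :=
  Nat.le_of_lt_succ (Nat.mod_lt _ two_pos)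

/-- Exchange at both ends at the same time. -/
theorem IsFree.exists_exchange {Ω : Set ℝ} (hΩ : IsCompact Ω) (hinf : Ω.Infinite)
    (htop : holeNumber Ω ≠ ⊤) {a b : ℝ} (ha : IsLeast Ω a) (hb : IsGreatest Ω b)
    {F : Finset (ℝ × ℝ)} (hF : IsFree Ω F) {sl sr : ℕ} (hsl : sl ≤ 1) (hsr : sr ≤ 1)
    (hFl : sl = 1 → ∀ I ∈ F, I.1 ≠ a) (hFr : sr = 1 → ∀ I ∈ F, I.2 ≠ b) :
    ∃ F', IsFree Ω F' ∧ F.card + thetaLeft Ω * sl + thetaRight Ω * sr ≤ F'.card ∧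
      (thetaLeft Ω = 0 → ∀ I ∈ F', I.1 ≠ a) ∧ (thetaRight Ω = 0 → ∀ I ∈ F', I.2 ≠ b) := by
  obtain ⟨c, c', hc, hc', hcc, hf, hf', hac, hac', hl, hr⟩ :=
    exists_extreme_limit_points hΩ hinf htop
  have htl : (Ω ∩ Set.Iio c).ncard % 2 = thetaLeft Ω := by rw [thetaLeft, hl]
  have htr : (Ω ∩ Set.Ioi c').ncard % 2 = thetaRight Ω := by rw [thetaRight, hr]
  obtain ⟨F₁, h1, h2, h3, h4, h5⟩ := hF.exists_exchange_left ha hc hf hac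
  obtain ⟨F₂, g1, g2, g3, g4, g5⟩ := h1.exists_exchange_right hb hc' hf' hac'
  rw [htl] at h4 h5
  rw [htr] at g4 g5
  refine ⟨F₂, g1, ?_, ?_, g4⟩
  · have e1 : F.card + thetaLeft Ω * sl ≤ F₁.card := by
      rcases Nat.le_one_iff_eq_zero_or_eq_one.1 (thetaLeft_le_one Ω) with ht | ht <;>
        rcases Nat.le_one_iff_eq_zero_or_eq_one.1 hsl with hs | hs <;> rw [ht, hs] <;>
        try simpa using h3
      simpa using h5 ht (hFl hs)
    have e2 : F₁.card + thetaRight Ω * sr ≤ F₂.card := by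
      rcases Nat.le_one_iff_eq_zero_or_eq_one.1 (thetaRight_le_one Ω) with ht | ht <;>
        rcases Nat.le_one_iff_eq_zero_or_eq_one.1 hsr with hs | hs <;> rw [ht, hs] <;>
        try simpa using g3
      suffices h : F₁.card + 1 ≤ F₂.card by simpa using h
      refine g5 ht fun I hI => ?_
      rcases h2 I hI with h | h
      · exact hFr hs I h
      · exact (h.trans_lt (hcc.trans_le (hb.2 hc'))).ne
    omega
  · intro ht I hI
    rcases g2 I hI with h | h
    · exact h4 ht I h
    · exact ((ha.2 hc).trans_lt (hcc.trans_le h)).ne'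

/-- The flags `sl`, `sr` promise that `F` avoids the extreme points; where the parity is odd, each
such promise is worth one additional hole. -/
theorem IsFree.card_add_le {Ω : Set ℝ} (hΩ : IsCompact Ω) (hinf : Ω.Infinite) {k : ℕ}
    (hk : holeNumber Ω = k) {a b : ℝ} (ha : IsLeast Ω a) (hb : IsGreatest Ω b)
    {F : Finset (ℝ × ℝ)} (hF : IsFree Ω F) {sl sr : ℕ} (hsl : sl ≤ 1) (hsr : sr ≤ 1)
    (hFl : sl = 1 → ∀ I ∈ F, I.1 ≠ a) (hFr : sr = 1 → ∀ I ∈ F, I.2 ≠ b) :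
    F.card + thetaLeft Ω * sl + thetaRight Ω * sr ≤ k := by
  obtain ⟨F', h1, h2, -⟩ := hF.exists_exchange hΩ hinf (by simp [hk]) ha hb hsl hsr hFl hFr
  have := h1.card_le
  rw [hk] at this
  norm_cast at this
  omega

/-- Used for the constructions: on a side of even parity the extreme point stays free to serve as a
further node. -/
theorem exists_isFree_avoiding {Ω : Set ℝ} (hΩ : IsCompact Ω) (hinf : Ω.Infinite) {k : ℕ}
    (hk : holeNumber Ω = k) {a b : ℝ} (ha : IsLeast Ω a) (hb : IsGreatest Ω b) :
    ∃ F, IsFree Ω F ∧ F.card = k ∧ (thetaLeft Ω = 0 → ∀ I ∈ F, I.1 ≠ a) ∧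
      (thetaRight Ω = 0 → ∀ I ∈ F, I.2 ≠ b) := by
  obtain ⟨F, hF, hFc⟩ := exists_isFree_card_eq hk.ge
  obtain ⟨F', h1, h2, h3, h4⟩ := hF.exists_exchange hΩ hinf (by simp [hk]) ha hb (sl := 0)
    (sr := 0) (by simp) (by simp) (by simp) (by simp)
  refine ⟨F', h1, ?_, h3, h4⟩
  have := h1.card_le
  rw [hk] at this
  norm_cast at this
  omega

/-! ### Counting zeros of polynomials nonnegative on `Ω` -/

/-- The zeros in `Ω` of a polynomial. -/
def zerosIn (Ω : Set ℝ) (f : Polynomial ℝ) : Set ℝ := {x | x ∈ Ω ∧ f.eval x = 0}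

theorem finite_zerosIn (Ω : Set ℝ) {f : Polynomial ℝ} (hf : f ≠ 0) : (zerosIn Ω f).Finite :=
  (Polynomial.finite_setOfPred_isRoot hf).subset fun _ hx => hx.2

theorem exists_eq_zero_of_sign_change {f : Polynomial ℝ} {x y : ℝ} (hx : f.eval x ≤ 0)
    (hy : 0 ≤ f.eval y) : ∃ z, f.eval z = 0 :=
  mem_range_of_exists_le_of_exists_ge f.continuous ⟨x, hx⟩ ⟨y, hy⟩

/-- The state of the left-to-right scan of the zeros of `f`. The family `F` collects holes on which
`f` changes sign at both ends, `s` records whether `f ≤ 0` up to some point `v` of `Ω`, and the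
last two conjuncts distinguish the sign of `f` near `+∞`. -/
def ScanState (Ω : Set ℝ) (f : Polynomial ℝ) (F : Finset (ℝ × ℝ)) (s : ℕ) (v : ℝ) : Prop :=
  IsFree Ω F ∧ (∀ I ∈ F, f.eval I.1 = 0 ∧ f.eval I.2 = 0) ∧ s ≤ 1 ∧
  (s = 1 → v ∈ Ω ∧ (∀ x ≤ v, f.eval x ≤ 0) ∧ ∀ I ∈ F, v < I.1) ∧
  (((∀ x, (∀ y, f.eval y = 0 → y < x) → 0 < f.eval x) ∧
      2 * (zerosIn Ω f).ncard ≤ f.natDegree + 2 * F.card + s) ∨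
    ((∀ x, (∀ y, f.eval y = 0 → y < x) → f.eval x < 0) ∧
      (2 * (zerosIn Ω f).ncard + 1 ≤ f.natDegree + 2 * F.card + s ∨
        (2 * (zerosIn Ω f).ncard ≤ f.natDegree + 2 * F.card + s + 1 ∧
          ∃ w ∈ Ω, (∀ x, w ≤ x → f.eval x ≤ 0) ∧ (∀ I ∈ F, I.2 < w) ∧ (s = 1 → v < w)) ∨
        (2 * (zerosIn Ω f).ncard ≤ f.natDegree ∧ F = ∅ ∧ s = 0 ∧ ∀ x, f.eval x ≤ 0))))

theorem exists_scanState_of_no_root {Ω : Set ℝ} {f : Polynomial ℝ} (h0 : ∀ x, f.eval x ≠ 0) :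
    ∃ F s v, ScanState Ω f F s v := by
  have hz : zerosIn Ω f = ∅ := Set.eq_empty_of_forall_notMem fun x hx => h0 x hx.2
  have hsgn : (∀ x, 0 < f.eval x) ∨ ∀ x, f.eval x < 0 := by
    by_contra! hn
    obtain ⟨⟨x, hx⟩, y, hy⟩ := hn
    obtain ⟨z, hz⟩ := exists_eq_zero_of_sign_change hx hy
    exact h0 z hz
  refine ⟨∅, 0, 0, ⟨by simp, by simp⟩, by simp, by simp, by simp, ?_⟩
  rcases hsgn with h | h
  · exact Or.inl ⟨fun x _ => h x, by simp [hz]⟩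
  · exact Or.inr ⟨fun x _ => h x, Or.inr (Or.inr ⟨by simp [hz], rfl, rfl, fun x => (h x).le⟩)⟩

theorem IsFree.of_inter_Iio {Ω : Set ℝ} {r : ℝ} {F : Finset (ℝ × ℝ)}
    (h : IsFree (Ω ∩ Set.Iio r) F) : IsFree Ω F := by
  refine ⟨fun I hI => ?_, h.2⟩
  obtain ⟨h1, h2, h3, h4⟩ := h.1 I hI
  refine ⟨h1.1, h2.1, h3, Set.disjoint_left.2 fun x hx hxΩ => ?_⟩
  exact Set.disjoint_left.1 h4 hx ⟨hxΩ, hx.2.trans h2.2⟩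

theorem ncard_zerosIn_of_notMem {Ω : Set ℝ} {f h : Polynomial ℝ} {r : ℝ} (hr : r ∉ Ω)
    (hroots : ∀ y, f.eval y = 0 → y ≤ r) (hlt : ∀ x < r, f.eval x = 0 ↔ h.eval x = 0) :
    (zerosIn Ω f).ncard = (zerosIn (Ω ∩ Set.Iio r) h).ncard := by
  congr 1
  ext x
  constructor
  · rintro ⟨h1, h2⟩
    have hxr : x < r := lt_of_le_of_ne (hroots x h2) fun e => hr (e ▸ h1)
    exact ⟨⟨h1, hxr⟩, (hlt x hxr).1 h2⟩
  · rintro ⟨⟨h1, h2⟩, h3⟩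
    exact ⟨h1, (hlt x h2).2 h3⟩

theorem ncard_zerosIn_le {Ω : Set ℝ} {f h : Polynomial ℝ} {r : ℝ} (hh : h ≠ 0)
    (hroots : ∀ y, f.eval y = 0 → y ≤ r) (hlt : ∀ x < r, f.eval x = 0 ↔ h.eval x = 0) :
    (zerosIn Ω f).ncard ≤ (zerosIn (Ω ∩ Set.Iio r) h).ncard + 1 := by
  refine (Set.ncard_le_ncard (t := insert r (zerosIn (Ω ∩ Set.Iio r) h)) ?_
    ((finite_zerosIn _ hh).insert r)).trans (Set.ncard_insert_le _ _)
  rintro x ⟨h1, h2⟩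
  rcases (hroots x h2).eq_or_lt with e | e
  · exact Or.inl e
  · exact Or.inr ⟨⟨h1, e⟩, (hlt x e).1 h2⟩

section Step

variable {Ω : Set ℝ} {f h : Polynomial ℝ} {r : ℝ} {μ : ℕ}

/-- No sign changes at `r`: the degree grows by at least two and the number of zeros by at most one,
so the balance and the sign information survive unchanged. -/
theorem exists_scanState_even (hh : h ≠ 0) (hμ : 2 ≤ μ) (hdeg : f.natDegree = μ + h.natDegree)
    (hfr : f.eval r = 0) (hhroots : ∀ y, h.eval y = 0 → y < r)
    (hlt : ∀ x, x ≠ r → ∃ ρ > 0, f.eval x = ρ * h.eval x)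
    (ih : ∃ F s v, ScanState (Ω ∩ Set.Iio r) h F s v) : ∃ F s v, ScanState Ω f F s v := by
  obtain ⟨F, s, v, h1, h2, h3, h4, h5⟩ := ih
  have hzero : ∀ x, x ≠ r → (f.eval x = 0 ↔ h.eval x = 0) := fun x hx => by
    obtain ⟨ρ, hρ, e⟩ := hlt x hx
    rw [e, mul_eq_zero, or_iff_right hρ.ne']
  have hnonpos : ∀ x, h.eval x ≤ 0 → f.eval x ≤ 0 := fun x hx => by
    rcases eq_or_ne x r with rfl | hne
    · exact hfr.le
    · obtain ⟨ρ, hρ, e⟩ := hlt x hne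
      rw [e]; exact mul_nonpos_of_nonneg_of_nonpos hρ.le hx
  have hfroots : ∀ y, f.eval y = 0 → y ≤ r := fun y hy => by
    by_contra! hlt'
    exact absurd (hhroots y ((hzero y hlt'.ne').1 hy)) hlt'.not_gt
  have hZ := ncard_zerosIn_le (Ω := Ω) hh hfroots fun x hx => hzero x hx.ne
  refine ⟨F, s, v, h1.of_inter_Iio, ?_, h3, ?_, ?_⟩
  · intro I hI
    have hm := h1.1 I hI
    exact ⟨(hzero _ hm.1.2.ne).2 (h2 I hI).1, (hzero _ hm.2.1.2.ne).2 (h2 I hI).2⟩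
  · intro hs
    obtain ⟨g1, g2, g3⟩ := h4 hs
    exact ⟨g1.1, fun x hx => hnonpos x (g2 x hx), g3⟩
  · rcases h5 with ⟨hpos, hc⟩ | ⟨hneg, hc⟩
    · refine Or.inl ⟨fun x hx => ?_, by omega⟩
      have hrx := hx r hfr
      obtain ⟨ρ, hρ, e⟩ := hlt x hrx.ne'
      rw [e]
      exact mul_pos hρ (hpos x fun y hy => (hhroots y hy).trans hrx)
    · refine Or.inr ⟨fun x hx => ?_, ?_⟩
      · have hrx := hx r hfr
        obtain ⟨ρ, hρ, e⟩ := hlt x hrx.ne'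
        rw [e]
        exact mul_neg_of_pos_of_neg hρ (hneg x fun y hy => (hhroots y hy).trans hrx)
      · rcases hc with hc | ⟨hc, w, hw, hw1, hw2, hw3⟩ | ⟨hc, hF, hs, hall⟩
        · left; omega
        · right; left
          exact ⟨by omega, w, hw.1, fun x hx => hnonpos x (hw1 x hx), hw2, hw3⟩
        · right; right
          exact ⟨by omega, hF, hs, fun x => hnonpos x (hall x)⟩

/-- The sign near `+∞` flips. Turning negative at `r ∈ Ω` creates a debt of one, recorded with `w =
r`; at `r ∉ Ω` it yields a surplus of one. Turning positive uses the surplus, or pays the debt by a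
root outside `Ω`, a new hole, or the flag `s`. -/
theorem exists_scanState_odd (hh : h ≠ 0) (hμ : 1 ≤ μ) (hdeg : f.natDegree = μ + h.natDegree)
    (hfr : f.eval r = 0) (hhroots : ∀ y, h.eval y = 0 → y < r)
    (hnn : ∀ x ∈ Ω, 0 ≤ f.eval x)
    (hlt : ∀ x < r, ∃ ρ > 0, f.eval x = ρ * h.eval x)
    (hgt : ∀ x, r < x → ∃ ρ > 0, f.eval x = -(ρ * h.eval x))
    (ih : ∃ F s v, ScanState (Ω ∩ Set.Iio r) h F s v) : ∃ F s v, ScanState Ω f F s v := by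
  obtain ⟨F, s, v, h1, h2, h3, h4, h5⟩ := ih
  have hzero : ∀ x < r, (f.eval x = 0 ↔ h.eval x = 0) := fun x hx => by
    obtain ⟨ρ, hρ, e⟩ := hlt x hx
    rw [e, mul_eq_zero, or_iff_right hρ.ne']
  have hnonpos : ∀ x < r, h.eval x ≤ 0 → f.eval x ≤ 0 := fun x hx hx' => by
    obtain ⟨ρ, hρ, e⟩ := hlt x hx
    rw [e]; exact mul_nonpos_of_nonneg_of_nonpos hρ.le hx'
  have hfroots : ∀ y, f.eval y = 0 → y ≤ r := fun y hy => by
    by_contra! hlt'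
    obtain ⟨ρ, hρ, e⟩ := hgt y hlt'
    rw [hy, eq_comm, neg_eq_zero, mul_eq_zero, or_iff_right hρ.ne'] at e
    exact absurd (hhroots y e) hlt'.not_gt
  have hZ := ncard_zerosIn_le (Ω := Ω) hh hfroots hzero
  have hF := h1.of_inter_Iio
  have hFz : ∀ I ∈ F, f.eval I.1 = 0 ∧ f.eval I.2 = 0 := by
    intro I hI
    have hm := h1.1 I hI
    exact ⟨(hzero _ hm.1.2).2 (h2 I hI).1, (hzero _ hm.2.1.2).2 (h2 I hI).2⟩
  have hs : s = 1 → v ∈ Ω ∧ (∀ x ≤ v, f.eval x ≤ 0) ∧ ∀ I ∈ F, v < I.1 := by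
    intro hs
    obtain ⟨g1, g2, g3⟩ := h4 hs
    exact ⟨g1.1, fun x hx => hnonpos x (hx.trans_lt g1.2) (g2 x hx), g3⟩
  rcases h5 with ⟨hpos, hc⟩ | ⟨hneg, hc⟩
  · have hneg : ∀ x, r < x → f.eval x < 0 := fun x hx => by
      obtain ⟨ρ, hρ, e⟩ := hgt x hx
      rw [e]
      exact neg_lt_zero.2 (mul_pos hρ (hpos x fun y hy => (hhroots y hy).trans hx))
    refine ⟨F, s, v, hF, hFz, h3, hs, Or.inr ⟨fun x hx => hneg x (hx r hfr), ?_⟩⟩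
    by_cases hr : r ∈ Ω
    · right; left
      refine ⟨by omega, r, hr, fun x hx => ?_, fun I hI => (h1.1 I hI).2.1.2,
        fun h => (h4 h).1.2⟩
      rcases hx.eq_or_lt with rfl | hx
      exacts [hfr.le, (hneg x hx).le]
    · have := ncard_zerosIn_of_notMem hr hfroots hzero
      left; omega
  · have hpos : ∀ x, (∀ y, f.eval y = 0 → y < x) → 0 < f.eval x := fun x hx => by
      have hrx := hx r hfr
      obtain ⟨ρ, hρ, e⟩ := hgt x hrx
      rw [e]
      exact neg_pos.2 (mul_neg_of_pos_of_neg hρ (hneg x fun y hy => (hhroots y hy).trans hrx))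
    rcases hc with hc | hc
    · exact ⟨F, s, v, hF, hFz, h3, hs, Or.inl ⟨hpos, by omega⟩⟩
    by_cases hr : r ∈ Ω
    swap
    · have := ncard_zerosIn_of_notMem hr hfroots hzero
      exact ⟨F, s, v, hF, hFz, h3, hs, Or.inl ⟨hpos, by omega⟩⟩
    rcases hc with ⟨hc, w, hw, hw1, hw2, hw3⟩ | ⟨hc, rfl, rfl, hall⟩
    -- Between `w` and `r` the polynomial is nonpositive, so the points of `Ω` there are zeros and
    -- finite in number; the last one, `q`, is the left end of a hole ending at `r`.
    · have hz : ∀ x ∈ Ω, w ≤ x → x < r → f.eval x = 0 := fun x hx hwx hxr =>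
        le_antisymm (hnonpos x hxr (hw1 x hwx)) (hnn x hx)
      have hfin : (Ω ∩ Set.Ico w r).Finite := (finite_zerosIn Set.univ hh).subset fun x hx =>
        ⟨trivial, (hzero x hx.2.2).1 (hz x hx.1 hx.2.1 hx.2.2)⟩
      obtain ⟨q, hq⟩ := hfin.isCompact.exists_isGreatest ⟨w, hw.1, le_rfl, hw.2⟩
      have hqr := hq.1.2.2
      have hqw := hq.1.2.1
      have hhole : (q, r) ∈ holes Ω := by
        refine ⟨hq.1.1, hr, hqr, Set.disjoint_left.2 fun x hx hxΩ => ?_⟩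
        exact absurd (hq.2 ⟨hxΩ, hqw.trans hx.1.le, hx.2⟩) (not_le.2 hx.1)
      obtain ⟨g1, g2⟩ := hF.insert_hole hhole fun J hJ => Or.inr ((hw2 J hJ).trans_le hqw)
      refine ⟨_, s, v, g1, ?_, h3, ?_, Or.inl ⟨hpos, by omega⟩⟩
      · intro I hI
        rcases Finset.mem_insert.1 hI with rfl | hI
        · exact ⟨hz q hq.1.1 hqw hqr, hfr⟩
        · exact hFz I hI
      · intro h
        obtain ⟨e1, e2, e3⟩ := hs h
        refine ⟨e1, e2, fun I hI => ?_⟩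
        rcases Finset.mem_insert.1 hI with rfl | hI
        · exact (hw3 h).trans_le hqw
        · exact e3 I hI
    -- This is the first sign change and has no partner on the left; it is charged to the flag `s`.
    · refine ⟨∅, 1, r, hF, hFz, le_rfl, fun _ => ⟨hr, fun x hx => ?_, by simp⟩,
        Or.inl ⟨hpos, by omega⟩⟩
      rcases hx.eq_or_lt with rfl | hx
      exacts [hfr.le, hnonpos x hx (hall x)]

end Step

/-- Strong induction on the degree, splitting off the greatest root with its full multiplicity. The
quotient, negated for odd multiplicity, is nonnegative on the part of `Ω` to the left of that root.
-/
theorem exists_scanState (N : ℕ) : ∀ (f : Polynomial ℝ) (Ω : Set ℝ), f ≠ 0 → f.natDegree = N →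
    (∀ x ∈ Ω, 0 ≤ f.eval x) → ∃ F s v, ScanState Ω f F s v := by
  induction N using Nat.strong_induction_on with
  | _ N ih =>
    intro f Ω hf hN hnn
    by_cases h0 : ∀ x, f.eval x ≠ 0
    · exact exists_scanState_of_no_root h0
    push Not at h0
    have hfin : {x | f.eval x = 0}.Finite := Polynomial.finite_setOfPred_isRoot hf
    obtain ⟨r, hr⟩ := hfin.isCompact.exists_isGreatest h0
    have hfr : f.eval r = 0 := hr.1
    obtain ⟨g, hg, hgr⟩ := Polynomial.exists_eq_pow_rootMultiplicity_mul_and_not_dvd f hf r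
    set μ := f.rootMultiplicity r with hμ
    have hμ1 : 1 ≤ μ := (Polynomial.rootMultiplicity_pos hf).2 hfr
    have hev : ∀ x, f.eval x = (x - r) ^ μ * g.eval x := fun x => by
      conv_lhs => rw [hg]
      simp
    have hg0 : g ≠ 0 := fun h => hf (by rw [hg, h, mul_zero])
    have hdeg : f.natDegree = μ + g.natDegree := by
      conv_lhs => rw [hg]
      rw [Polynomial.natDegree_mul (pow_ne_zero _ (Polynomial.X_sub_C_ne_zero r)) hg0,
        Polynomial.natDegree_pow, Polynomial.natDegree_X_sub_C, mul_one]
    have hgroots : ∀ y, g.eval y = 0 → y < r := fun y hy => by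
      refine lt_of_le_of_ne (hr.2 (show f.eval y = 0 by rw [hev, hy, mul_zero])) fun e => hgr ?_
      exact Polynomial.dvd_iff_isRoot.2 (e ▸ hy)
    rcases Nat.even_or_odd μ with hpar | hpar
    · have hsgn : ∀ x, x ≠ r → ∃ ρ > 0, f.eval x = ρ * g.eval x := fun x hx =>
        ⟨(x - r) ^ μ, hpar.pow_pos (sub_ne_zero.2 hx), hev x⟩
      refine exists_scanState_even hg0 (by rcases hpar with ⟨c, hc⟩; omega) hdeg hfr hgroots hsgn
        (ih g.natDegree (by omega) g _ hg0 rfl fun x hx => ?_)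
      obtain ⟨ρ, hρ, e⟩ := hsgn x hx.2.ne
      exact nonneg_of_mul_nonneg_right (e ▸ hnn x hx.1) hρ
    · have hsgn : ∀ x < r, ∃ ρ > 0, f.eval x = ρ * (-g).eval x := fun x hx =>
        ⟨(r - x) ^ μ, pow_pos (sub_pos.2 hx) μ, by
          rw [hev, ← neg_sub r x, hpar.neg_pow, Polynomial.eval_neg]; ring⟩
      refine exists_scanState_odd (neg_ne_zero.2 hg0) hμ1 (by rw [hdeg, Polynomial.natDegree_neg])
        hfr (fun y hy => hgroots y (by simpa using hy)) hnn hsgn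
        (fun x hx => ⟨(x - r) ^ μ, pow_pos (sub_pos.2 hx) μ, by
          rw [hev, Polynomial.eval_neg]; ring⟩)
        (ih _ (by omega) (-g) _ (neg_ne_zero.2 hg0) (Polynomial.natDegree_neg g) fun x hx => ?_)
      obtain ⟨ρ, hρ, e⟩ := hsgn x hx.2
      exact nonneg_of_mul_nonneg_right (e ▸ hnn x hx.1) hρ

/-- The number of zeros in `Ω` of a polynomial that is nonnegative on `Ω`, bounded in terms of its
degree and of a free family of holes all of whose endpoints are zeros. -/
theorem exists_isFree_two_mul_ncard_zerosIn_le {Ω : Set ℝ} {a b : ℝ} (ha : IsLeast Ω a)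
    (hb : IsGreatest Ω b) {f : Polynomial ℝ} (hf : f ≠ 0) (hnn : ∀ x ∈ Ω, 0 ≤ f.eval x) :
    ∃ (F : Finset (ℝ × ℝ)) (sl sr : ℕ), IsFree Ω F ∧ (∀ I ∈ F, f.eval I.1 = 0 ∧ f.eval I.2 = 0) ∧
      sl ≤ 1 ∧ sr ≤ 1 ∧ (sl = 1 → f.eval a = 0 ∧ ∀ I ∈ F, I.1 ≠ a) ∧
      (sr = 1 → f.eval b = 0 ∧ ∀ I ∈ F, I.2 ≠ b) ∧
      2 * (zerosIn Ω f).ncard ≤ f.natDegree + 2 * F.card + sl + sr := by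
  obtain ⟨F, s, v, h1, h2, h3, h4, h5⟩ := exists_scanState _ f Ω hf rfl hnn
  have hl : s = 1 → f.eval a = 0 ∧ ∀ I ∈ F, I.1 ≠ a := fun h => by
    obtain ⟨g1, g2, g3⟩ := h4 h
    exact ⟨le_antisymm (g2 a (ha.2 g1)) (hnn a ha.1),
      fun I hI => ((ha.2 g1).trans_lt (g3 I hI)).ne'⟩
  rcases h5 with ⟨-, hc⟩ | ⟨-, hc | ⟨hc, w, hw, hw1, hw2, -⟩ | ⟨hc, -⟩⟩
  · exact ⟨F, s, 0, h1, h2, h3, by simp, hl, by simp, by omega⟩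
  · exact ⟨F, s, 0, h1, h2, h3, by simp, hl, by simp, by omega⟩
  -- A debt still open at the end is charged to the greatest point `b`, where `f` is both
  -- nonpositive and nonnegative.
  · exact ⟨F, s, 1, h1, h2, h3, le_rfl, hl, fun _ =>
      ⟨le_antisymm (hw1 b (hb.2 hw)) (hnn b hb.1), fun I hI => ((hw2 I hI).trans_le (hb.2 hw)).ne⟩,
      by omega⟩
  · exact ⟨F, s, 0, h1, h2, h3, by simp, hl, by simp, by omega⟩

/-! ### Lower bounds: building nodes from local factors -/

theorem mem_polySpace {Ω : Set ℝ} {m : ℕ} {f : C(Ω, ℝ)} :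
    f ∈ polySpace Ω m ↔ ∃ p : Polynomial ℝ, p.natDegree ≤ m ∧ p.toContinuousMapOn Ω = f := by
  constructor
  · rintro ⟨p, hp, rfl⟩
    exact ⟨p, Polynomial.natDegree_le_iff_degree_le.2 (Polynomial.mem_degreeLE.1 hp), rfl⟩
  · rintro ⟨p, hp, rfl⟩
    exact ⟨p, Polynomial.mem_degreeLE.2 (Polynomial.natDegree_le_iff_degree_le.1 hp), rfl⟩

/-- Nodes `N ⊆ Ω` together with polynomials that are nonnegative on `Ω`: one of degree at most `t`
vanishing in `Ω` exactly on `N`, and for each node one of degree less than `M` vanishing exactly on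
the other nodes. -/
def IsConfig (Ω : Set ℝ) (N : Finset ℝ) (t M : ℕ) : Prop :=
  (∀ x ∈ N, x ∈ Ω) ∧
  (∃ T : Polynomial ℝ, T.natDegree ≤ t ∧ (∀ x ∈ Ω, 0 ≤ T.eval x) ∧
    ∀ x ∈ Ω, (T.eval x = 0 ↔ x ∈ N)) ∧
  ∀ z ∈ N, ∃ S : Polynomial ℝ, S.natDegree + 1 ≤ M ∧ (∀ x ∈ Ω, 0 ≤ S.eval x) ∧
    ∀ x ∈ Ω, (S.eval x = 0 ↔ x ∈ N ∧ x ≠ z)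

theorem isConfig_empty (Ω : Set ℝ) : IsConfig Ω ∅ 0 0 :=
  ⟨by simp, ⟨1, by simp, by simp, by simp⟩, by simp⟩

/-- The node polynomial of one configuration is multiplied by the polynomial of the other that
vanishes on all its nodes. -/
theorem IsConfig.union {Ω : Set ℝ} {N N' : Finset ℝ} {t t' M M' K : ℕ} (h : IsConfig Ω N t M)
    (h' : IsConfig Ω N' t' M') (hd : Disjoint N N') (hK : M + t' ≤ K) (hK' : M' + t ≤ K) :
    IsConfig Ω (N ∪ N') (t + t') K := by
  obtain ⟨h1, ⟨T, hT1, hT2, hT3⟩, h3⟩ := h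
  obtain ⟨h1', ⟨T', hT1', hT2', hT3'⟩, h3'⟩ := h'
  refine ⟨fun x hx => (Finset.mem_union.1 hx).elim (h1 x) (h1' x), ⟨T * T', ?_, ?_, ?_⟩, ?_⟩
  · exact Polynomial.natDegree_mul_le.trans (add_le_add hT1 hT1')
  · intro x hx
    rw [Polynomial.eval_mul]
    exact mul_nonneg (hT2 x hx) (hT2' x hx)
  · intro x hx
    rw [Polynomial.eval_mul, mul_eq_zero, hT3 x hx, hT3' x hx, Finset.mem_union]
  · intro z hz
    rcases Finset.mem_union.1 hz with hz | hz
    · obtain ⟨S, g1, g2, g3⟩ := h3 z hz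
      refine ⟨S * T', ?_, ?_, ?_⟩
      · have := Polynomial.natDegree_mul_le (p := S) (q := T')
        omega
      · intro x hx
        rw [Polynomial.eval_mul]
        exact mul_nonneg (g2 x hx) (hT2' x hx)
      · intro x hx
        rw [Polynomial.eval_mul, mul_eq_zero, g3 x hx, hT3' x hx, Finset.mem_union]
        have : x ∈ N' → x ≠ z := fun hx' e => Finset.disjoint_left.1 hd hz (e ▸ hx')
        tauto
    · obtain ⟨S, g1, g2, g3⟩ := h3' z hz
      refine ⟨T * S, ?_, ?_, ?_⟩
      · have := Polynomial.natDegree_mul_le (p := T) (q := S)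
        omega
      · intro x hx
        rw [Polynomial.eval_mul]
        exact mul_nonneg (hT2 x hx) (g2 x hx)
      · intro x hx
        rw [Polynomial.eval_mul, mul_eq_zero, hT3 x hx, g3 x hx, Finset.mem_union]
        have : x ∈ N → x ≠ z := fun hx' e => Finset.disjoint_right.1 hd hz (e ▸ hx')
        tauto

-- To free one endpoint, its linear factor is moved to the midpoint of the hole; dropping it would
-- spoil the sign. Hence no degree is saved, and `M` is `3`.
open Polynomial in
theorem isConfig_hole {Ω : Set ℝ} {I : ℝ × ℝ} (hI : I ∈ holes Ω) : IsConfig Ω {I.1, I.2} 2 3 := by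
  obtain ⟨h1, h2, h3, h4⟩ := hI
  have hside : ∀ x ∈ Ω, x ≤ I.1 ∨ I.2 ≤ x := fun x hx => by
    by_contra! hn
    exact Set.disjoint_left.1 h4 ⟨hn.1, hn.2⟩ hx
  have key : ∀ u v, I.1 ≤ u → u ≤ v → v ≤ I.2 →
      ((X - C u) * (X - C v) : ℝ[X]).natDegree ≤ 2 ∧
      (∀ x ∈ Ω, 0 ≤ ((X - C u) * (X - C v) : ℝ[X]).eval x) ∧
      ∀ x, ((X - C u) * (X - C v) : ℝ[X]).eval x = 0 ↔ x = u ∨ x = v := by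
    intro u v hu huv hv
    refine ⟨natDegree_mul_le.trans (by simp), fun x hx => ?_, fun x => by simp [sub_eq_zero]⟩
    simp only [eval_mul, eval_sub, eval_X, eval_C]
    rcases hside x hx with h | h
    · exact mul_nonneg_of_nonpos_of_nonpos (by linarith) (by linarith)
    · exact mul_nonneg (by linarith) (by linarith)
  have hmid : ∀ x ∈ Ω, x ≠ (I.1 + I.2) / 2 := fun x hx e => by
    rcases hside x hx with h | h <;> linarith
  refine ⟨by simp [h1, h2], ?_, ?_⟩
  · obtain ⟨k1, k2, k3⟩ := key I.1 I.2 le_rfl h3.le le_rfl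
    exact ⟨_, k1, k2, fun x _ => by rw [k3, Finset.mem_insert, Finset.mem_singleton]⟩
  · intro z hz
    rw [Finset.mem_insert, Finset.mem_singleton] at hz
    rcases hz with rfl | rfl
    · obtain ⟨k1, k2, k3⟩ := key ((I.1 + I.2) / 2) I.2 (by linarith) (by linarith) le_rfl
      refine ⟨_, by omega, k2, fun x hx => ?_⟩
      rw [k3, or_iff_right (hmid x hx), Finset.mem_insert, Finset.mem_singleton]
      have := h3.ne'
      constructor
      · rintro rfl; exact ⟨Or.inr rfl, this⟩
      · tauto
    · obtain ⟨k1, k2, k3⟩ := key I.1 ((I.1 + I.2) / 2) le_rfl (by linarith) (by linarith)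
      refine ⟨_, by omega, k2, fun x hx => ?_⟩
      rw [k3, or_iff_left (hmid x hx), Finset.mem_insert, Finset.mem_singleton]
      have := h3.ne
      constructor
      · rintro rfl; exact ⟨Or.inl rfl, this⟩
      · tauto

theorem isConfig_singleton {Ω : Set ℝ} {y : ℝ} (hy : y ∈ Ω) {T : Polynomial ℝ}
    (hT : ∀ x ∈ Ω, 0 ≤ T.eval x) (hT' : ∀ x ∈ Ω, (T.eval x = 0 ↔ x = y)) :
    IsConfig Ω {y} T.natDegree 1 := by
  refine ⟨by simpa using hy, ⟨T, le_rfl, hT, by simpa using hT'⟩, fun z hz => ?_⟩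
  rw [Finset.mem_singleton] at hz
  exact ⟨1, by simp, by simp, fun x _ => by simp [hz]⟩

open Polynomial in
theorem isConfig_isLeast {Ω : Set ℝ} {a : ℝ} (ha : IsLeast Ω a) : IsConfig Ω {a} 1 1 := by
  have := isConfig_singleton (T := X - C a) ha.1 (fun x hx => by simpa using ha.2 hx)
    fun x _ => by simp [sub_eq_zero]
  rwa [natDegree_X_sub_C] at this

open Polynomial in
theorem isConfig_isGreatest {Ω : Set ℝ} {b : ℝ} (hb : IsGreatest Ω b) : IsConfig Ω {b} 1 1 := by
  have := isConfig_singleton (T := -(X - C b)) hb.1 (fun x hx => by simpa using hb.2 hx)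
    fun x _ => by simp [sub_eq_zero, eq_comm]
  rwa [natDegree_neg, natDegree_X_sub_C] at this

open Polynomial in
theorem isConfig_mem {Ω : Set ℝ} {y : ℝ} (hy : y ∈ Ω) : IsConfig Ω {y} 2 1 := by
  have := isConfig_singleton (T := (X - C y) ^ 2) hy (fun x hx => by simpa using sq_nonneg (x - y))
    fun x _ => by simp [sub_eq_zero]
  rwa [natDegree_pow, natDegree_X_sub_C] at this

/-- The endpoints of the members of a family of intervals. -/
noncomputable def endpoints (F : Finset (ℝ × ℝ)) : Finset ℝ := F.biUnion fun I => {I.1, I.2}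

theorem mem_endpoints {F : Finset (ℝ × ℝ)} {x : ℝ} :
    x ∈ endpoints F ↔ ∃ I ∈ F, x = I.1 ∨ x = I.2 := by
  simp [endpoints]

theorem IsFree.isConfig {Ω : Set ℝ} {F : Finset (ℝ × ℝ)} (hF : IsFree Ω F) :
    IsConfig Ω (endpoints F) (2 * F.card) (if F = ∅ then 0 else 2 * F.card + 1) ∧
      (endpoints F).card = 2 * F.card := by
  induction F using Finset.induction_on with
  | empty => simpa [endpoints] using isConfig_empty Ω
  | insert I F hI ih =>
    obtain ⟨ih1, ih2⟩ := ih (hF.mono (Finset.subset_insert I F))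
    have hIh := hF.1 I (Finset.mem_insert_self I F)
    have hlt := hIh.2.2.1
    have hd : Disjoint ({I.1, I.2} : Finset ℝ) (endpoints F) := by
      refine Finset.disjoint_left.2 fun x hx hx' => ?_
      obtain ⟨J, hJ, hxJ⟩ := mem_endpoints.1 hx'
      have hlt' := (hF.1 J (Finset.mem_insert_of_mem hJ)).2.2.1
      have hdis := hF.2 I (Finset.mem_insert_self I F) J (Finset.mem_insert_of_mem hJ)
        fun e => hI (e ▸ hJ)
      rw [Finset.mem_insert, Finset.mem_singleton] at hx
      rcases hx with rfl | rfl <;> rcases hxJ with e | e <;> rcases hdis with h | h <;> linarith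
    have hins : endpoints (insert I F) = {I.1, I.2} ∪ endpoints F := Finset.biUnion_insert
    rw [hins, Finset.card_union_of_disjoint hd, Finset.card_pair hlt.ne, ih2,
      Finset.card_insert_of_notMem hI, if_neg (Finset.insert_ne_empty I F)]
    refine ⟨?_, by ring⟩
    have h2 : 2 * (F.card + 1) = 2 + 2 * F.card := by ring
    rw [h2]
    refine (isConfig_hole hIh).union ih1 hd (by omega) ?_
    split_ifs <;> omega

/-- Evaluation at the nodes diagonalises the family: each coordinate of `f` is its value at a node
divided by a positive number. -/
theorem IsConfig.card_mem {Ω : Set ℝ} {N : Finset ℝ} {t m : ℕ} (h : IsConfig Ω N t (m + 1)) :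
    N.card ∈ positiveBasisDims Ω m := by
  obtain ⟨h1, -, h3⟩ := h
  choose! S hS1 hS2 hS3 using h3
  set e := N.equivFin.symm with he
  have heN : ∀ i, (e i : ℝ) ∈ N := fun i => (e i).2
  set g : Fin N.card → C(Ω, ℝ) := fun i => (S (e i)).toContinuousMapOn Ω with hg
  have hgz : ∀ i j, i ≠ j → g j ⟨e i, h1 _ (heN i)⟩ = 0 := fun i j hij =>
    (hS3 _ (heN j) _ (h1 _ (heN i))).2 ⟨heN i, fun h => hij (e.injective (Subtype.ext h))⟩
  have hgp : ∀ i, 0 < g i ⟨e i, h1 _ (heN i)⟩ := fun i => by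
    refine lt_of_le_of_ne (hS2 _ (heN i) _ (h1 _ (heN i))) fun h => ?_
    exact ((hS3 _ (heN i) _ (h1 _ (heN i))).1 h.symm).2 rfl
  have hsum : ∀ (c : Fin N.card → ℝ) i,
      (∑ j, c j • g j) ⟨e i, h1 _ (heN i)⟩ = c i * g i ⟨e i, h1 _ (heN i)⟩ := fun c i => by
    rw [ContinuousMap.sum_apply, Finset.sum_eq_single i]
    · rfl
    · intro j _ hj
      rw [ContinuousMap.smul_apply, hgz i j hj.symm, smul_zero]
    · simp
  have hli : LinearIndependent ℝ g := by
    rw [Fintype.linearIndependent_iff]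
    intro c hc i
    have := hsum c i
    rw [hc, ContinuousMap.zero_apply, eq_comm, mul_eq_zero] at this
    exact this.resolve_right (hgp i).ne'
  set b := Module.Basis.span hli with hb
  have hbi : ∀ i, (b i : C(Ω, ℝ)) = g i := fun i =>
    congrArg Subtype.val (Module.Basis.span_apply hli i)
  refine ⟨Submodule.span ℝ (Set.range g), ?_, ⟨N.card, b, ?_, ?_⟩, ?_⟩
  · rw [Submodule.span_le]
    rintro _ ⟨i, rfl⟩
    exact mem_polySpace.2 ⟨_, by have := hS1 _ (heN i); omega, rfl⟩
  · intro i
    rw [hbi, ContinuousMap.le_def]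
    exact fun x => hS2 _ (heN i) x x.2
  · intro f hf i
    have h2 := congrArg (Subtype.val) (b.sum_repr f)
    rw [Submodule.coe_sum] at h2
    simp only [Submodule.coe_smul, hbi] at h2
    have h4 := hsum (fun j => b.repr f j) i
    rw [h2] at h4
    have h5 := (ContinuousMap.le_def.1 hf) ⟨e i, h1 _ (heN i)⟩
    rw [h4] at h5
    exact nonneg_of_mul_nonneg_left h5 (hgp i)
  · rw [Module.finrank_eq_card_basis b, Fintype.card_fin]

/-- The dimensions realised by taking as nodes the endpoints of a free family of holes, possibly the
extreme points of `Ω`, and `d` further points. -/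
theorem IsFree.add_mem_positiveBasisDims {Ω : Set ℝ} (hinf : Ω.Infinite) {a b : ℝ}
    (ha : IsLeast Ω a) (hb : IsGreatest Ω b) {F : Finset (ℝ × ℝ)} (hF : IsFree Ω F) {el er : ℕ}
    (hel : el ≤ 1) (her : er ≤ 1) (hFl : el = 1 → ∀ I ∈ F, I.1 ≠ a)
    (hFr : er = 1 → ∀ I ∈ F, I.2 ≠ b) {d m : ℕ} (hm : 2 * F.card + el + er + 2 * d ≤ m + 1)
    (hm' : F ≠ ∅ → 2 * F.card + el + er + 2 * d ≤ m) :
    2 * F.card + el + er + d ∈ positiveBasisDims Ω m := by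
  -- Without holes every node polynomial can drop the factor of its own node, so one more degree is
  -- affordable; this is the difference between `hm` and `hm'`.
  obtain ⟨N₀, M₀, hN₀, hM₀, hM₁, hc₀, hmem₀⟩ : ∃ (N : Finset ℝ) (M : ℕ),
      IsConfig Ω N (2 * F.card) M ∧ 2 * F.card ≤ M ∧ M + el + er + 2 * d ≤ m + 1 ∧
      N.card = 2 * F.card ∧ N = endpoints F := by
    refine ⟨_, _, hF.isConfig.1, ?_, ?_, hF.isConfig.2, rfl⟩
    · split_ifs with h <;> simp [h]
    · split_ifs with h
      · omega
      · have := hm' h; omega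
  have hab : a < b := by
    refine lt_of_le_of_ne (ha.2 hb.1) fun h => hinf ((Set.finite_singleton a).subset fun x hx => ?_)
    exact le_antisymm (h ▸ hb.2 hx) (ha.2 hx)
  obtain ⟨N₁, hN₁, hc₁, hmem₁⟩ : ∃ N, IsConfig Ω N (2 * F.card + el) (M₀ + el) ∧
      N.card = 2 * F.card + el ∧ ∀ x ∈ N, x ∈ endpoints F ∨ x = a := by
    rcases Nat.le_one_iff_eq_zero_or_eq_one.1 hel with rfl | rfl
    · exact ⟨N₀, hN₀, hc₀, fun x hx => Or.inl (hmem₀ ▸ hx)⟩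
    · have hd : Disjoint N₀ {a} := by
        rw [Finset.disjoint_singleton_right, hmem₀, mem_endpoints]
        rintro ⟨I, hI, h | h⟩
        · exact hFl rfl I hI h.symm
        · exact absurd (ha.2 (hF.1 I hI).1) (not_le.2 (h ▸ (hF.1 I hI).2.2.1))
      refine ⟨_, hN₀.union (isConfig_isLeast ha) hd le_rfl (by omega), ?_, ?_⟩
      · rw [Finset.card_union_of_disjoint hd, hc₀, Finset.card_singleton]
      · intro x hx
        rw [Finset.mem_union, Finset.mem_singleton, hmem₀] at hx
        exact hx
  obtain ⟨N₂, hN₂, hc₂⟩ : ∃ N, IsConfig Ω N (2 * F.card + el + er) (M₀ + el + er) ∧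
      N.card = 2 * F.card + el + er := by
    rcases Nat.le_one_iff_eq_zero_or_eq_one.1 her with rfl | rfl
    · exact ⟨N₁, hN₁, hc₁⟩
    · have hd : Disjoint N₁ {b} := by
        rw [Finset.disjoint_singleton_right]
        intro hbN
        rcases hmem₁ b hbN with h | h
        · obtain ⟨I, hI, h | h⟩ := mem_endpoints.1 h
          · exact absurd (hb.2 (hF.1 I hI).2.1) (not_le.2 (h ▸ (hF.1 I hI).2.2.1))
          · exact hFr rfl I hI h.symm
        · exact hab.ne' h
      refine ⟨_, hN₁.union (isConfig_isGreatest hb) hd le_rfl (by omega), ?_⟩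
      rw [Finset.card_union_of_disjoint hd, hc₁, Finset.card_singleton]
  have hD : ∀ d, ∃ N t, t = 2 * F.card + el + er + 2 * d ∧
      IsConfig Ω N t (M₀ + el + er + 2 * d) ∧ N.card = 2 * F.card + el + er + d := by
    intro d
    induction d with
    | zero => exact ⟨N₂, _, rfl, hN₂, hc₂⟩
    | succ d ih =>
      obtain ⟨N, t, ht, hN, hc⟩ := ih
      obtain ⟨y, hy, hyN⟩ := hinf.exists_notMem_finset N
      have hd : Disjoint N {y} := Finset.disjoint_singleton_right.2 hyN
      refine ⟨_, _, ?_, hN.union (isConfig_mem hy) hd (K := M₀ + el + er + 2 * (d + 1)) (by omega)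
        (by omega), ?_⟩
      · omega
      · rw [Finset.card_union_of_disjoint hd, hc, Finset.card_singleton]; omega
  obtain ⟨N, t, -, hN, hc⟩ := hD d
  rw [← hc]
  refine IsConfig.card_mem (t := t) ⟨hN.1, ?_, ?_⟩
  · exact hN.2.1
  · intro z hz
    obtain ⟨S, hS, hS'⟩ := hN.2.2 z hz
    exact ⟨S, by omega, hS'⟩

/-! ### Cancelling common zeros at limit points -/

theorem eval_nonneg_of_mem_closure {f : Polynomial ℝ} {s : Set ℝ} {x : ℝ} (hx : x ∈ closure s)
    (h : ∀ y ∈ s, 0 ≤ f.eval y) : 0 ≤ f.eval x :=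
  closure_minimal (t := {y | 0 ≤ f.eval y}) h (isClosed_le continuous_const f.continuous) hx

open Classical in
/-- The number of roots in `Ω`, counted with multiplicity. -/
noncomputable def rootCount (Ω : Set ℝ) (f : Polynomial ℝ) : ℕ := (f.roots.filter (· ∈ Ω)).card

theorem rootCount_mul {Ω : Set ℝ} {f g : Polynomial ℝ} (h : f * g ≠ 0) :
    rootCount Ω (f * g) = rootCount Ω f + rootCount Ω g := by
  rw [rootCount, Polynomial.roots_mul h, Multiset.filter_add, Multiset.card_add]
  rfl

theorem rootCount_eq_zero {Ω : Set ℝ} {f : Polynomial ℝ} (h : ∀ y ∈ Ω, f.eval y ≠ 0) :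
    rootCount Ω f = 0 := by
  classical
  rw [rootCount, Multiset.card_eq_zero, Multiset.filter_eq_nil]
  exact fun y hy hyΩ => h y hyΩ (Polynomial.isRoot_of_mem_roots hy)

theorem rootCount_pos {Ω : Set ℝ} {f : Polynomial ℝ} (hf : f ≠ 0) {x : ℝ} (hx : x ∈ Ω)
    (h : f.eval x = 0) : 0 < rootCount Ω f := by
  classical
  exact Multiset.card_pos_iff_exists_mem.2
    ⟨x, Multiset.mem_filter.2 ⟨(Polynomial.mem_roots hf).2 h, hx⟩⟩

section Cancel

variable {Ω : Set ℝ} {ι : Type*} {B : ι → Polynomial ℝ} {m : ℕ} {x : ℝ}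

/-- Replacing a common factor that vanishes in `Ω` only at a limit point `x` by one without zeros
in `Ω`. -/
theorem exists_cancel_of_dvd (hx : x ∈ Ω) (hacc : x ∈ closure (Ω \ {x})) (hB : ∀ j, B j ≠ 0)
    (hdeg : ∀ j, (B j).natDegree ≤ m) (hnn : ∀ j, ∀ y ∈ Ω, 0 ≤ (B j).eval y)
    {V W : Polynomial ℝ} (hdvd : ∀ j, V ∣ B j) (hVW : W.natDegree ≤ V.natDegree)
    (hV : V.eval x = 0) (hW : W.eval x ≠ 0) (hsgn : ∀ y ∈ Ω, y ≠ x → 0 < V.eval y * W.eval y) :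
    ∃ C : ι → Polynomial ℝ, (∀ j, (C j).natDegree ≤ m) ∧ (∀ j, ∀ y ∈ Ω, 0 ≤ (C j).eval y) ∧
      (∀ y ∈ Ω, y ≠ x → ∃ ρ > 0, ∀ j, (C j).eval y = ρ * (B j).eval y) ∧
      ∀ j, rootCount Ω (C j) < rootCount Ω (B j) := by
  choose D hD using hdvd
  have hD0 : ∀ j, D j ≠ 0 := fun j h => hB j (by rw [hD j, h, mul_zero])
  have hV0 : ∀ j : ι, V ≠ 0 := fun j h => hB j (by rw [hD j, h, zero_mul])
  have hW0 : W ≠ 0 := fun h => hW (by rw [h, Polynomial.eval_zero])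
  have hρ : ∀ y ∈ Ω, y ≠ x → ∃ ρ > 0, ∀ j, (W * D j).eval y = ρ * (B j).eval y := by
    intro y hy hyx
    have h := hsgn y hy hyx
    have hVy : V.eval y ≠ 0 := fun e => by simp [e] at h
    refine ⟨W.eval y / V.eval y, ?_, fun j => ?_⟩
    · rcases mul_pos_iff.1 h with ⟨h1, h2⟩ | ⟨h1, h2⟩
      exacts [div_pos h2 h1, div_pos_of_neg_of_neg h2 h1]
    · rw [hD j, Polynomial.eval_mul, Polynomial.eval_mul]
      field_simp
  refine ⟨fun j => W * D j, fun j => ?_, fun j => ?_, hρ, fun j => ?_⟩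
  · have := hdeg j
    rw [hD j, Polynomial.natDegree_mul (hV0 j) (hD0 j)] at this
    exact (Polynomial.natDegree_mul_le (p := W) (q := D j)).trans (by omega)
  · have hne : ∀ y ∈ Ω \ {x}, 0 ≤ (W * D j).eval y := fun y hy => by
      obtain ⟨ρ, hρ0, e⟩ := hρ y hy.1 hy.2
      rw [e]
      exact mul_nonneg hρ0.le (hnn j y hy.1)
    intro y hy
    by_cases hyx : y = x
    · rw [hyx]; exact eval_nonneg_of_mem_closure hacc hne
    · exact hne y ⟨hy, hyx⟩
  · have h1 : rootCount Ω W = 0 := rootCount_eq_zero fun y hy e => by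
      by_cases hyx : y = x
      · exact hW (hyx ▸ e)
      · have := hsgn y hy hyx
        simp [e] at this
    have h2 := rootCount_pos (hV0 j) hx hV
    have h3 := rootCount_mul (Ω := Ω) (hD j ▸ hB j)
    rw [← hD j] at h3
    rw [rootCount_mul (mul_ne_zero hW0 (hD0 j))]
    omega

open Polynomial in
/-- A common zero at a limit point can be removed from a family of polynomials that are
nonnegative on `Ω`. -/
theorem exists_cancel (hx : x ∈ Ω) (hacc : x ∈ closure (Ω \ {x})) (hB : ∀ j, B j ≠ 0)
    (hdeg : ∀ j, (B j).natDegree ≤ m) (hnn : ∀ j, ∀ y ∈ Ω, 0 ≤ (B j).eval y)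
    (hzero : ∀ j, (B j).eval x = 0) :
    ∃ C : ι → Polynomial ℝ, (∀ j, (C j).natDegree ≤ m) ∧ (∀ j, ∀ y ∈ Ω, 0 ≤ (C j).eval y) ∧
      (∀ y ∈ Ω, y ≠ x → ∃ ρ > 0, ∀ j, (C j).eval y = ρ * (B j).eval y) ∧
      ∀ j, rootCount Ω (C j) < rootCount Ω (B j) := by
  have hdvd : ∀ j, X - C x ∣ B j := fun j => dvd_iff_isRoot.2 (hzero j)
  by_cases hl : x ∈ closure (Ω ∩ Set.Iio x)
  · by_cases hr : x ∈ closure (Ω ∩ Set.Ioi x)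
    -- At a two-sided limit point the cofactor `D` is nonnegative on the right and nonpositive on
    -- the left, so it vanishes at `x` and the square can be cancelled.
    · refine exists_cancel_of_dvd hx hacc hB hdeg hnn (V := (X - C x) ^ 2) (W := 1) (fun j => ?_)
        (by simp) (by simp) (by simp) fun y _ hy => ?_
      · obtain ⟨D, hD⟩ := hdvd j
        have hev : ∀ y, (B j).eval y = (y - x) * D.eval y := fun y => by rw [hD]; simp
        have h1 : 0 ≤ D.eval x := eval_nonneg_of_mem_closure hr fun y hy =>
          nonneg_of_mul_nonneg_right (hev y ▸ hnn j y hy.1) (sub_pos.2 hy.2)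
        have h2 : 0 ≤ (-D).eval x := eval_nonneg_of_mem_closure hl fun y hy => by
          have h3 := hnn j y hy.1
          rw [hev y] at h3
          rw [eval_neg]
          exact nonneg_of_mul_nonneg_right (a := x - y) (by linarith) (sub_pos.2 hy.2)
        rw [eval_neg] at h2
        obtain ⟨E, hE⟩ := dvd_iff_isRoot.2 (show D.IsRoot x from le_antisymm (by linarith) h1)
        exact ⟨E, by rw [hD, hE]; ring⟩
      · have := sub_ne_zero.2 hy
        simp only [eval_pow, eval_sub, eval_X, eval_C, eval_one, mul_one]
        positivity
    · rw [Metric.mem_closure_iff] at hr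
      push Not at hr
      obtain ⟨δ, hδ, hr⟩ := hr
      -- At a one-sided limit point the zero is pushed into the gap of `Ω` next to `x`, keeping
      -- degree and signs.
      refine exists_cancel_of_dvd hx hacc hB hdeg hnn hdvd (W := X - C (x + δ / 2))
        (by simp only [natDegree_X_sub_C, le_refl]) (by simp) ?_ fun y hy hyx => ?_
      · simp only [eval_sub, eval_X, eval_C]; linarith
      · simp only [eval_sub, eval_X, eval_C]
        rcases lt_or_gt_of_ne hyx with h | h
        · exact mul_pos_of_neg_of_neg (by linarith) (by linarith)
        · have := hr y ⟨hy, h⟩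
          rw [Real.dist_eq, abs_of_neg (by linarith)] at this
          exact mul_pos (by linarith) (by linarith)
  · rw [Metric.mem_closure_iff] at hl
    push Not at hl
    obtain ⟨δ, hδ, hl⟩ := hl
    refine exists_cancel_of_dvd hx hacc hB hdeg hnn hdvd (W := X - C (x - δ / 2))
      (by simp only [natDegree_X_sub_C, le_refl]) (by simp) ?_ fun y hy hyx => ?_
    · simp only [eval_sub, eval_X, eval_C]; linarith
    · simp only [eval_sub, eval_X, eval_C]
      rcases lt_or_gt_of_ne hyx with h | h
      · have := hl y ⟨hy, h⟩
        rw [Real.dist_eq, abs_of_pos (by linarith)] at this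
        exact mul_pos_of_neg_of_neg (by linarith) (by linarith)
      · exact mul_pos (by linarith) (by linarith)

end Cancel

/-! ### From a positive basis to a node system -/

/-- Each member of the family `B` dominates all the others at suitable points of `Ω`. -/
def IsDominating (Ω : Set ℝ) {ι : Type*} (B : ι → Polynomial ℝ) : Prop :=
  ∀ i, ∀ ε > 0, ∃ y ∈ Ω, 0 < (B i).eval y ∧ ∀ j, j ≠ i → (B j).eval y ≤ ε * (B i).eval y

theorem IsDominating.exists_limit {Ω : Set ℝ} (hΩ : IsCompact Ω) {ι : Type*}
    {B : ι → Polynomial ℝ} (hnn : ∀ j, ∀ y ∈ Ω, 0 ≤ (B j).eval y) (hB : IsDominating Ω B) (i : ι) :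
    ∃ x ∈ Ω, (∀ j, j ≠ i → (B j).eval x = 0) ∧
      (0 < (B i).eval x ∨ (B i).eval x = 0 ∧ x ∈ closure (Ω \ {x})) := by
  choose y hyΩ hypos hyle using fun k : ℕ => hB i (1 / ((k : ℝ) + 1)) (by positivity)
  obtain ⟨x, hx, φ, hφ, hlim⟩ := hΩ.tendsto_subseq hyΩ
  refine ⟨x, hx, fun j hj => le_antisymm ?_ (hnn j x hx), ?_⟩
  · have h1 := (((B j).continuous.tendsto x).comp hlim)
    have h2 := (tendsto_one_div_add_atTop_nhds_zero_nat.comp hφ.tendsto_atTop).mul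
      (((B i).continuous.tendsto x).comp hlim)
    rw [zero_mul] at h2
    exact le_of_tendsto_of_tendsto' h1 h2 fun k => hyle (φ k) j hj
  · rcases (hnn i x hx).lt_or_eq with h | h
    · exact Or.inl h
    · refine Or.inr ⟨h.symm, mem_closure_of_tendsto hlim (Filter.Eventually.of_forall fun k => ?_)⟩
      refine ⟨hyΩ _, fun e => ?_⟩
      have := hypos (φ k)
      rw [show y (φ k) = x from e, ← h] at this
      exact lt_irrefl _ this

/-- Induction on the total number of roots in `Ω`. A cancellation lowers it and multiplies all
members by the same positive number at each remaining point, so domination persists. -/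
theorem IsDominating.exists_nodes {Ω : Set ℝ} (hΩ : IsCompact Ω) {ι : Type*} [Fintype ι] {m : ℕ}
    (N : ℕ) : ∀ B : ι → Polynomial ℝ, ∑ j, rootCount Ω (B j) = N → (∀ j, (B j).natDegree ≤ m) →
      (∀ j, ∀ y ∈ Ω, 0 ≤ (B j).eval y) → IsDominating Ω B →
      ∃ (B' : ι → Polynomial ℝ) (x : ι → ℝ), (∀ j, (B' j).natDegree ≤ m) ∧
        (∀ j, ∀ y ∈ Ω, 0 ≤ (B' j).eval y) ∧ (∀ i, x i ∈ Ω) ∧ (∀ i, 0 < (B' i).eval (x i)) ∧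
        ∀ i j, j ≠ i → (B' j).eval (x i) = 0 := by
  induction N using Nat.strong_induction_on with
  | _ N ih =>
    intro B hN hdeg hnn hB
    choose x hx hx0 hxi using fun i => hB.exists_limit hΩ hnn i
    by_cases hgood : ∀ i, 0 < (B i).eval (x i)
    · exact ⟨B, x, hdeg, hnn, hx, hgood, hx0⟩
    push Not at hgood
    obtain ⟨i, hi⟩ := hgood
    obtain ⟨hi0, hacc⟩ := (hxi i).resolve_left (not_lt.2 hi)
    have hB0 : ∀ j, B j ≠ 0 := fun j h => by
      obtain ⟨y, -, hy, -⟩ := hB j 1 one_pos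
      simp [h] at hy
    obtain ⟨C, h1, h2, h3, h4⟩ := exists_cancel (hx i) hacc hB0 hdeg hnn fun j => by
      by_cases hj : j = i
      · rw [hj, hi0]
      · exact hx0 i j hj
    refine ih _ ?_ C rfl h1 h2 fun l ε hε => ?_
    · rw [← hN]
      exact Finset.sum_lt_sum_of_nonempty ⟨i, Finset.mem_univ i⟩ fun j _ => h4 j
    · obtain ⟨y, hy, hy1, hy2⟩ := hB l ε hε
      have hyx : y ≠ x i := by
        rintro rfl
        by_cases hl : l = i
        · rw [hl, hi0] at hy1; exact lt_irrefl _ hy1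
        · rw [hx0 i l hl] at hy1; exact lt_irrefl _ hy1
      obtain ⟨ρ, hρ, e⟩ := h3 y hy hyx
      refine ⟨y, hy, by rw [e]; exact mul_pos hρ hy1, fun j hj => ?_⟩
      rw [e, e, mul_left_comm]
      exact mul_le_mul_of_nonneg_left (hy2 j hj) hρ.le

/-- The data dual to a positive basis: nodes in `Ω` and polynomials that are nonnegative on `Ω`,
each vanishing at all the nodes but its own. -/
structure NodeSystem (Ω : Set ℝ) (m n : ℕ) where
  poly : Fin n → Polynomial ℝ
  node : Fin n → ℝ
  natDegree_le : ∀ j, (poly j).natDegree ≤ m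
  nonneg : ∀ j, ∀ y ∈ Ω, 0 ≤ (poly j).eval y
  node_mem : ∀ i, node i ∈ Ω
  pos : ∀ i, 0 < (poly i).eval (node i)
  eq_zero : ∀ i j, j ≠ i → (poly j).eval (node i) = 0

theorem nonempty_nodeSystem {Ω : Set ℝ} (hΩ : IsCompact Ω) {m n : ℕ}
    (hn : n ∈ positiveBasisDims Ω m) : Nonempty (NodeSystem Ω m n) := by
  obtain ⟨X, hX, ⟨n', b, hb, hb'⟩, hfin⟩ := hn
  obtain rfl : n' = n := by
    rw [← hfin, Module.finrank_eq_card_basis b, Fintype.card_fin]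
  choose B hBdeg hB using fun j => mem_polySpace.1 (hX (b j).2)
  have hev : ∀ j (y : Ω), (b j : C(Ω, ℝ)) y = (B j).eval (y : ℝ) := fun j y => by
    rw [← hB j]; rfl
  have hnn : ∀ j, ∀ y ∈ Ω, 0 ≤ (B j).eval y := fun j y hy => by
    have := ContinuousMap.le_def.1 (hb j) ⟨y, hy⟩
    rwa [hev] at this
  have hdom : IsDominating Ω B := by
    intro i ε hε
    by_contra! hcon
    -- If domination failed, wherever `b i` is positive some other `b j` would exceed `ε • b i`;
    -- then `f` is nonnegative although its `i`-th coordinate is `-ε`.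
    set f : X := ∑ j ∈ Finset.univ.erase i, b j - ε • b i with hf
    have hf0 : 0 ≤ (f : C(Ω, ℝ)) := by
      rw [ContinuousMap.le_def]
      intro y
      have hfy : (f : C(Ω, ℝ)) y =
          ∑ j ∈ Finset.univ.erase i, (B j).eval (y : ℝ) - ε * (B i).eval (y : ℝ) := by
        rw [hf]
        simp only [Submodule.coe_sub, Submodule.coe_sum, Submodule.coe_smul,
          ContinuousMap.sub_apply, ContinuousMap.sum_apply, ContinuousMap.smul_apply, hev,
          smul_eq_mul]
      rw [hfy, ContinuousMap.zero_apply]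
      have hsum : ∀ j ∈ Finset.univ.erase i, 0 ≤ (B j).eval (y : ℝ) := fun j _ => hnn j y y.2
      rcases (hnn i y y.2).eq_or_lt with h | h
      · rw [← h, mul_zero, sub_zero]
        exact Finset.sum_nonneg hsum
      · obtain ⟨j, hj, hlt⟩ := hcon y y.2 h
        have := Finset.single_le_sum hsum (Finset.mem_erase.2 ⟨hj, Finset.mem_univ j⟩)
        linarith
    have h1 := hb' f hf0 i
    have h2 : b.repr f i = -ε := by
      rw [hf, map_sub, map_smul, map_sum, Finsupp.sub_apply, Finsupp.smul_apply,
        Finsupp.finsetSum_apply, Finset.sum_eq_zero]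
      · simp
      · intro j hj
        rw [b.repr_self, Finsupp.single_eq_of_ne (Finset.ne_of_mem_erase hj).symm]
    linarith
  obtain ⟨B', x, h1, h2, h3, h4, h5⟩ := IsDominating.exists_nodes hΩ _ B rfl hBdeg hnn hdom
  exact ⟨⟨B', x, h1, h2, h3, h4, h5⟩⟩

/-! ### Upper bounds for node systems -/

namespace NodeSystem

variable {Ω : Set ℝ} {m n : ℕ}

theorem node_injective (S : NodeSystem Ω m n) : Function.Injective S.node := fun i j h => by
  by_contra hne
  have := S.pos i
  rw [h, S.eq_zero j i hne] at this
  exact lt_irrefl _ this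

theorem poly_ne_zero (S : NodeSystem Ω m n) (j : Fin n) : S.poly j ≠ 0 := fun h => by
  have := S.pos j
  simp [h] at this

theorem le_ncard_add_one (S : NodeSystem Ω m n) (j : Fin n) : n ≤ (zerosIn Ω (S.poly j)).ncard + 1 := by
  have h : S.node '' {j}ᶜ ⊆ zerosIn Ω (S.poly j) := by
    rintro _ ⟨i, hi, rfl⟩
    exact ⟨S.node_mem i, S.eq_zero i j fun e => hi e.symm⟩
  have h1 := Set.ncard_le_ncard h (finite_zerosIn Ω (S.poly_ne_zero j))
  rw [Set.ncard_image_of_injective _ S.node_injective, Set.ncard_compl, Set.ncard_singleton,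
    Nat.card_eq_fintype_card, Fintype.card_fin] at h1
  omega

/-- The other `n - 1` nodes are already zeros, so a tight count leaves no room for another zero in
`Ω`. -/
theorem exists_eq_node (S : NodeSystem Ω m n) {j : Fin n} (hc : (zerosIn Ω (S.poly j)).ncard + 1 ≤ n) {y : ℝ}
    (hy : y ∈ Ω) (hy0 : (S.poly j).eval y = 0) : ∃ i, S.node i = y := by
  have h : S.node '' {j}ᶜ ⊆ zerosIn Ω (S.poly j) := by
    rintro _ ⟨i, hi, rfl⟩
    exact ⟨S.node_mem i, S.eq_zero i j fun e => hi e.symm⟩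
  have h1 := Set.eq_of_subset_of_ncard_le h (by
    rw [Set.ncard_image_of_injective _ S.node_injective, Set.ncard_compl, Set.ncard_singleton,
      Nat.card_eq_fintype_card, Fintype.card_fin]
    omega) (finite_zerosIn Ω (S.poly_ne_zero j))
  have h2 : y ∈ S.node '' {j}ᶜ := h1 ▸ ⟨hy, hy0⟩
  obtain ⟨i, -, hi⟩ := h2
  exact ⟨i, hi⟩

open Polynomial in
/-- In dimension `m + 1` the function `(y - x) ^ 2` would be a nonnegative combination. -/
theorem le_degree (S : NodeSystem Ω m n) (hinf : Ω.Infinite) (hm : 2 ≤ m) : n ≤ m := by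
  have hdeg0 : ∀ j y, (∀ i, S.node i ≠ y) → (S.poly j).eval y = 0 → n ≤ m := by
    intro j y hy hy0
    have hcard : (Finset.univ.image S.node).card = n := by
      rw [Finset.card_image_of_injective _ S.node_injective, Finset.card_univ, Fintype.card_fin]
    by_contra! hlt
    refine S.poly_ne_zero j (eq_zero_of_natDegree_lt_card_of_eval_eq_zero (S.poly j)
      -- Exchanging the own node of `poly j` for the further zero `y` gives `n > m` distinct zeros.
      (f := Function.update S.node j y) ?_ (fun i => ?_) ?_)
    · intro i l hil
      by_cases hi : i = j <;> by_cases hl : l = j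
      · rw [hi, hl]
      · rw [hi, Function.update_self, Function.update_of_ne hl] at hil
        exact absurd hil.symm (hy l)
      · rw [hl, Function.update_self, Function.update_of_ne hi] at hil
        exact absurd hil (hy i)
      · rw [Function.update_of_ne hl, Function.update_of_ne hi] at hil
        exact S.node_injective hil
    · by_cases hi : i = j
      · rw [hi, Function.update_self, hy0]
      · rw [Function.update_of_ne hi, S.eq_zero i j fun e => hi e.symm]
    · rw [Fintype.card_fin]
      exact (S.natDegree_le j).trans_lt hlt
  by_contra! hlt
  obtain ⟨y, hy, hyn⟩ := hinf.exists_notMem_finset (Finset.univ.image S.node)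
  have hyn' : ∀ i, S.node i ≠ y := fun i e =>
    hyn (Finset.mem_image.2 ⟨i, Finset.mem_univ i, e⟩)
  set q : ℝ[X] := (X - C y) ^ 2 with hq
  set c : Fin n → ℝ := fun i => q.eval (S.node i) / (S.poly i).eval (S.node i) with hc
  have hqpos : ∀ i, 0 < q.eval (S.node i) := fun i => by
    have := sub_ne_zero.2 (hyn' i)
    simp only [hq, eval_pow, eval_sub, eval_X, eval_C]
    positivity
  -- Both sides have degree at most `m` and agree at more than `m` nodes. At `y` this is a vanishing
  -- sum of nonnegative terms with positive coefficients.
  have hid : q - ∑ i, C (c i) * S.poly i = 0 := by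
    refine eq_zero_of_natDegree_lt_card_of_eval_eq_zero _ S.node_injective (fun i => ?_) ?_
    · rw [eval_sub, eval_finsetSum, Finset.sum_eq_single i]
      · rw [eval_mul, eval_C, hc]
        field_simp [(S.pos i).ne']
        ring
      · intro j _ hj
        rw [eval_mul, S.eq_zero i j hj, mul_zero]
      · simp
    · rw [Fintype.card_fin]
      refine (natDegree_sub_le_of_le (m := m) (n := m) ?_ ?_).trans_lt (by simpa using hlt)
      · rw [hq, natDegree_pow, natDegree_X_sub_C]; omega
      · exact natDegree_sum_le_of_forall_le _ _ fun i _ =>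
          (natDegree_C_mul_le _ _).trans (S.natDegree_le i)
  have hev := congrArg (eval y) hid
  rw [eval_sub, eval_finsetSum, eval_zero] at hev
  simp only [eval_mul, eval_C] at hev
  have hqy : q.eval y = 0 := by simp [hq]
  rw [hqy, zero_sub, neg_eq_zero, Finset.sum_eq_zero_iff_of_nonneg fun i _ =>
    mul_nonneg (div_nonneg (hqpos i).le (S.pos i).le) (S.nonneg i y hy)] at hev
  have hn : 0 < n := by omega
  have h0 := (mul_eq_zero.1 (hev ⟨0, hn⟩ (Finset.mem_univ _))).resolve_left
    (div_pos (hqpos _) (S.pos _)).ne'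
  exact absurd (hdeg0 _ y hyn' h0) (not_le.2 hlt)

/-- Beyond the bound, every node polynomial must use both flags and so vanish at the least point
`a`; but tightness makes `a` a node, where its own polynomial is positive. -/
theorem two_mul_le_of_holeNumber_eq_zero (S : NodeSystem Ω m n) (hΩ : IsCompact Ω) (hinf : Ω.Infinite)
    (h0 : holeNumber Ω = 0) : 2 * n ≤ m + 3 := by
  obtain ⟨a, ha⟩ := hΩ.exists_isLeast hinf.nonempty
  obtain ⟨b, hb⟩ := hΩ.exists_isGreatest hinf.nonempty
  by_contra! hlt
  choose F sl sr hF hFz hsl hsr hl hr hcount using fun j =>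
    exists_isFree_two_mul_ncard_zerosIn_le ha hb (S.poly_ne_zero j) (S.nonneg j)
  have key : ∀ j, sl j = 1 ∧ (zerosIn Ω (S.poly j)).ncard + 1 ≤ n := by
    intro j
    have h1 := (hF j).card_le
    rw [h0] at h1
    have h2 : (F j).card = 0 := by exact_mod_cast le_antisymm h1 zero_le
    have := hcount j
    have := S.le_ncard_add_one j
    have := hsl j
    have := hsr j
    have := S.natDegree_le j
    omega
  have hn : 0 < n := by omega
  obtain ⟨h1, h2⟩ := key ⟨0, hn⟩
  obtain ⟨i, hi⟩ := S.exists_eq_node h2 ha.1 (hl _ h1).1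
  have := S.pos i
  rw [hi, (hl i (key i).1).1] at this
  exact lt_irrefl _ this

theorem two_mul_add_le (S : NodeSystem Ω m n) (hΩ : IsCompact Ω) (hinf : Ω.Infinite) {k : ℕ}
    (hk : holeNumber Ω = k) (hk1 : 1 ≤ k) :
    2 * n + thetaLeft Ω + thetaRight Ω ≤ m + 2 + 2 * k := by
  obtain ⟨a, ha⟩ := hΩ.exists_isLeast hinf.nonempty
  obtain ⟨b, hb⟩ := hΩ.exists_isGreatest hinf.nonempty
  by_contra! hlt
  choose F sl sr hF hFz hsl hsr hl hr hcount using fun j =>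
    exists_isFree_two_mul_ncard_zerosIn_le ha hb (S.poly_ne_zero j) (S.nonneg j)
  have htl := thetaLeft_le_one Ω
  have htr := thetaRight_le_one Ω
  -- The negated inequality forces equality in the parity bound and leaves no zeros other than the
  -- nodes.
  have key : ∀ j, (zerosIn Ω (S.poly j)).ncard + 1 ≤ n ∧
      (F j).card + thetaLeft Ω * sl j + thetaRight Ω * sr j = k := by
    intro j
    have h1 := (hF j).card_add_le hΩ hinf hk ha hb (hsl j) (hsr j) (fun h => (hl j h).2)
      fun h => (hr j h).2
    have h2 := hcount j
    have h3 := S.le_ncard_add_one j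
    have h4 := S.natDegree_le j
    rcases Nat.le_one_iff_eq_zero_or_eq_one.1 htl with e1 | e1 <;>
      rcases Nat.le_one_iff_eq_zero_or_eq_one.1 htr with e2 | e2 <;>
      rcases Nat.le_one_iff_eq_zero_or_eq_one.1 (hsl j) with e3 | e3 <;>
      rcases Nat.le_one_iff_eq_zero_or_eq_one.1 (hsr j) with e4 | e4 <;>
      rw [e1, e2, e3, e4] at h1 <;> rw [e3, e4] at h2 <;> rw [e1, e2] at hlt <;>
      rw [e1, e2, e3, e4] <;> omega
  have hleft : ∀ j, thetaLeft Ω * sl j = 0 := by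
    intro j
    by_contra hne
    rw [mul_eq_zero, not_or] at hne
    have e1 : thetaLeft Ω = 1 := by omega
    have e2 : sl j = 1 := by have := hsl j; omega
    obtain ⟨i, hi⟩ := S.exists_eq_node (key j).1 ha.1 (hl j e2).1
    have hpos := S.pos i
    rw [hi] at hpos
    have e3 : sl i = 0 := by
      have := hsl i
      by_contra hne
      exact hpos.ne' (hl i (by omega)).1
    -- Since `poly i` is positive at `a`, its family avoids `a`, so the parity bound holds with `sl`
    -- raised from `0` to `1`, against equality.
    have := (hF i).card_add_le hΩ hinf hk ha hb (sl := 1) le_rfl (hsr i)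
      (fun _ I hI e => hpos.ne' (e ▸ (hFz i I hI).1)) fun h => (hr i h).2
    have := (key i).2
    rw [e3] at this
    omega
  have hright : ∀ j, thetaRight Ω * sr j = 0 := by
    intro j
    by_contra hne
    rw [mul_eq_zero, not_or] at hne
    have e1 : thetaRight Ω = 1 := by omega
    have e2 : sr j = 1 := by have := hsr j; omega
    obtain ⟨i, hi⟩ := S.exists_eq_node (key j).1 hb.1 (hr j e2).1
    have hpos := S.pos i
    rw [hi] at hpos
    have e3 : sr i = 0 := by
      have := hsr i
      by_contra hne
      exact hpos.ne' (hr i (by omega)).1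
    have := (hF i).card_add_le hΩ hinf hk ha hb (sr := 1) (hsl i) le_rfl
      (fun h => (hl i h).2) (fun _ I hI e => hpos.ne' (e ▸ (hFz i I hI).2))
    have := (key i).2
    rw [e3] at this
    omega
  have hcard : ∀ j, (F j).card = k := fun j => by
    have := (key j).2
    rw [hleft, hright] at this
    omega
  have hn : 0 < n := by omega
  have hne : (Finset.univ.biUnion F).Nonempty := by
    obtain ⟨I, hI⟩ := Finset.card_pos.1 (hk1.trans_eq (hcard ⟨0, hn⟩).symm)
    exact ⟨I, Finset.mem_biUnion.2 ⟨_, Finset.mem_univ _, hI⟩⟩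
  -- The hole with the least right end among all families ends at some node `i`. As `poly i` is
  -- positive there, every member of `F i` lies strictly to the right, so `I` can be added to a
  -- family already of maximal size `k`.
  obtain ⟨I, hI, hmin⟩ := Finset.exists_min_image (Finset.univ.biUnion F) Prod.snd hne
  obtain ⟨j, -, hIj⟩ := Finset.mem_biUnion.1 hI
  have hIh := (hF j).1 I hIj
  obtain ⟨i, hi⟩ := S.exists_eq_node (key j).1 hIh.2.1 (hFz j I hIj).2
  have hpos := S.pos i
  rw [hi] at hpos
  obtain ⟨h1, h2⟩ := (hF i).insert_hole hIh fun J hJ => by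
    have hJh := (hF i).1 J hJ
    have h3 : I.2 < J.2 := lt_of_le_of_ne
      (hmin J (Finset.mem_biUnion.2 ⟨i, Finset.mem_univ i, hJ⟩))
      fun e => hpos.ne' (e ▸ (hFz i J hJ).2)
    refine Or.inl (lt_of_le_of_ne (not_lt.1 fun h => ?_) fun e => hpos.ne' (e ▸ (hFz i J hJ).1))
    exact Set.disjoint_left.1 hJh.2.2.2 ⟨h, h3⟩ hIh.2.1
  have := h1.card_le
  rw [h2, hcard, hk] at this
  norm_cast at this
  omega

end NodeSystem

/-! ### Assembling the four cases -/

theorem IsFree.exists_subset_avoiding {Ω : Set ℝ} {F : Finset (ℝ × ℝ)} (hF : IsFree Ω F) {a : ℝ}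
    {d : ℕ} (hd : F.card = d + 1) : ∃ G ⊆ F, G.card = d ∧ ∀ I ∈ G, I.1 ≠ a := by
  obtain ⟨I, hI, hIa⟩ : ∃ I ∈ F, ∀ J ∈ F, J.1 = a → J = I := by
    by_cases h : ∃ I ∈ F, I.1 = a
    · obtain ⟨I, hI, hIa⟩ := h
      refine ⟨I, hI, fun J hJ hJa => ?_⟩
      by_contra hne
      have h1 := (hF.1 I hI).2.2.1
      have h2 := (hF.1 J hJ).2.2.1
      rcases hF.2 J hJ I hI hne with h | h <;> linarith
    · push Not at h
      obtain ⟨I, hI⟩ := Finset.card_pos.1 (hd.symm ▸ Nat.succ_pos d : 0 < F.card)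
      exact ⟨I, hI, fun J hJ e => absurd e (h J hJ)⟩
  refine ⟨F.erase I, Finset.erase_subset _ _, by rw [Finset.card_erase_of_mem hI, hd]; rfl, ?_⟩
  exact fun J hJ e => Finset.ne_of_mem_erase hJ (hIa J (Finset.mem_of_mem_erase hJ) e)

/-- For even `m` the endpoints of `m / 2` free holes suffice. For odd `m` one hole more is
available; discarding one, chosen to begin at `a` if any does, lets `a` be the odd node. -/
theorem mem_positiveBasisDims_of_le_two_mul {Ω : Set ℝ} (hΩ : IsCompact Ω) (hinf : Ω.Infinite)
    {m : ℕ} (h : (m : ℕ∞) ≤ 2 * holeNumber Ω) : m ∈ positiveBasisDims Ω m := by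
  obtain ⟨a, ha⟩ := hΩ.exists_isLeast hinf.nonempty
  obtain ⟨b, hb⟩ := hΩ.exists_isGreatest hinf.nonempty
  have hle : (((m + 1) / 2 : ℕ) : ℕ∞) ≤ holeNumber Ω := by
    by_cases htop : holeNumber Ω = ⊤
    · rw [htop]; exact le_top
    · obtain ⟨k, hk⟩ := ENat.ne_top_iff_exists.1 htop
      rw [← hk] at h ⊢
      norm_cast at h ⊢
      omega
  obtain ⟨F, hF, hFc⟩ := exists_isFree_card_eq hle
  rcases Nat.even_or_odd' m with ⟨d, rfl | rfl⟩
  · have := hF.add_mem_positiveBasisDims hinf ha hb (el := 0) (er := 0) (d := 0) (m := 2 * d)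
      (by simp) (by simp) (by simp) (by simp) (by omega) (by omega)
    convert this using 1
    omega
  · obtain ⟨G, hGF, hG, hGa⟩ := hF.exists_subset_avoiding (a := a) (d := d) (by omega)
    have := (hF.mono hGF).add_mem_positiveBasisDims hinf ha hb (el := 1) (er := 0) (d := 0)
      (m := 2 * d + 1) (by simp) (by simp) (fun _ => hGa) (by simp) (by omega) (by omega)
    convert this using 1
    omega

theorem mainTheorem1 (Ω : Set ℝ) (hΩ : IsCompact Ω) (hinf : Ω.Infinite) (m : ℕ) :
    (2 ≤ m → (m : ℕ∞) ≤ 2 * holeNumber Ω → IsGreatest (positiveBasisDims Ω m) m) ∧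
    (2 ≤ m → (m : ℕ∞) = 2 * holeNumber Ω + 1 →
      IsGreatest (positiveBasisDims Ω m) (m - thetaLeft Ω * thetaRight Ω)) ∧
    (∀ k : ℕ, holeNumber Ω = k → 1 ≤ k → 2 * k + 2 ≤ m →
      IsGreatest (positiveBasisDims Ω m) ((m - thetaLeft Ω - thetaRight Ω) / 2 + 1 + k)) ∧
    (holeNumber Ω = 0 → IsGreatest (positiveBasisDims Ω m) ((m + 3) / 2)) := by
  obtain ⟨a, ha⟩ := hΩ.exists_isLeast hinf.nonempty
  obtain ⟨b, hb⟩ := hΩ.exists_isGreatest hinf.nonempty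
  have htl := thetaLeft_le_one Ω
  have htr := thetaRight_le_one Ω
  refine ⟨fun hm h => ⟨mem_positiveBasisDims_of_le_two_mul hΩ hinf h, fun n hn => ?_⟩,
    fun hm h => ?_, fun k hk hk1 hkm => ⟨?_, fun n hn => ?_⟩, fun h0 => ⟨?_, fun n hn => ?_⟩⟩
  · obtain ⟨S⟩ := nonempty_nodeSystem hΩ hn
    exact S.le_degree hinf hm
  · obtain ⟨k, hk⟩ : ∃ k : ℕ, (k : ℕ∞) = holeNumber Ω := by
      refine ENat.ne_top_iff_exists.1 fun htop => ?_
      rw [htop] at h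
      exact absurd h (by simp)
    have hmk : m = 2 * k + 1 := by
      rw [← hk] at h
      exact_mod_cast h
    obtain ⟨F, hF, hFc, hFa, hFb⟩ := exists_isFree_avoiding hΩ hinf hk.symm ha hb
    constructor
    · rcases Nat.le_one_iff_eq_zero_or_eq_one.1 htl with el | el
      · have := hF.add_mem_positiveBasisDims hinf ha hb (el := 1) (er := 0) (d := 0) (m := m)
          (by simp) (by simp) (fun _ => hFa el) (by simp) (by omega) (by omega)
        convert this using 1
        rw [el]; omega
      · rcases Nat.le_one_iff_eq_zero_or_eq_one.1 htr with er | er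
        · have := hF.add_mem_positiveBasisDims hinf ha hb (el := 0) (er := 1) (d := 0) (m := m)
            (by simp) (by simp) (by simp) (fun _ => hFb er) (by omega) (by omega)
          convert this using 1
          rw [er]; omega
        · have := hF.add_mem_positiveBasisDims hinf ha hb (el := 0) (er := 0) (d := 0) (m := m)
            (by simp) (by simp) (by simp) (by simp) (by omega) (by omega)
          convert this using 1
          rw [el, er]; omega
    · intro n hn
      obtain ⟨S⟩ := nonempty_nodeSystem hΩ hn
      have h1 := S.le_degree hinf hm
      have h2 := S.two_mul_add_le hΩ hinf hk.symm (by omega)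
      rcases Nat.le_one_iff_eq_zero_or_eq_one.1 htl with el | el <;>
        rcases Nat.le_one_iff_eq_zero_or_eq_one.1 htr with er | er <;>
        rw [el, er] at h2 ⊢ <;> omega
  · obtain ⟨F, hF, hFc, hFa, hFb⟩ := exists_isFree_avoiding hΩ hinf hk ha hb
    -- An extreme point is a node exactly on the sides of even parity; the remaining degree is spent
    -- on further points at two per node.
    have := hF.add_mem_positiveBasisDims hinf ha hb (el := 1 - thetaLeft Ω)
      (er := 1 - thetaRight Ω)
      (d := (m - 2 * k - (1 - thetaLeft Ω) - (1 - thetaRight Ω)) / 2) (m := m)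
      (by omega) (by omega) (fun _ => hFa (by omega)) (fun _ => hFb (by omega)) (by omega)
      (by omega)
    convert this using 1
    omega
  · obtain ⟨S⟩ := nonempty_nodeSystem hΩ hn
    have := S.two_mul_add_le hΩ hinf hk hk1
    omega
  · have h : IsFree Ω ∅ := ⟨by simp, by simp⟩
    rcases Nat.even_or_odd' m with ⟨d, rfl | rfl⟩
    · have := h.add_mem_positiveBasisDims hinf ha hb (el := 1) (er := 0) (d := d) (m := 2 * d)
        (by simp) (by simp) (by simp) (by simp) (by simp; omega) (by simp)
      convert this using 1
      simp; omega
    · have := h.add_mem_positiveBasisDims hinf ha hb (el := 1) (er := 1) (d := d) (m := 2 * d + 1)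
        (by simp) (by simp) (by simp) (by simp) (by simp; omega) (by simp)
      convert this using 1
      simp; omega
  · obtain ⟨S⟩ := nonempty_nodeSystem hΩ hn
    have := S.two_mul_le_of_holeNumber_eq_zero hΩ hinf h0
    omega
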